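/- Let $a,c>0$, $d\in\mathbb N$, and put $\beta:=a/c$, $r_t(x):=\sqrt{c^2t^2-x^2}$; let $I_0$ be the modified Bessel function of the first kind of order $0$. A one-dimensional Kac process starting in $0$ is $K(t)=B\,c\int_0^t(-1)^{N(s)}\,\mathrm ds$, $t\ge 0$, where $(N(t))_{t\ge0}$ is a homogeneous Poisson point process with rate $a$ and $B$ is a random variable independent of $N$ with $\mathbb P(B=1)=\mathbb P(B=-1)=\tfrac12$. A $d$-dimensional Kac process starting in $0$ is $\mathbf K(t)=(K^1(t),\dots,K^d(t))$ with i.i.d. copies $K^i$ of such a process. Fix $x_0\in\mathbb R^d$ and let $\mathbf X_t:=x_0+\mathbf K(t)$, $t\ge0$, be the VE Kac process starting in $x_0$. Then the laws $\mu_t(\cdot|x_0):=P_{\mathbf X_t}$ form a narrowly continuous curve of probability measures with finite second moments on $\mathbb R^d$ and satisfy the continuity equation $$\partial_t\mu_t+\nabla_x\cdot(\mu_t v_t)=0$$ in the sense of distributions on $(0,\infty)\times\mathbb R^d$, with the velocity field $$v_t(x|x_0):=\big(v_t^1(x^1|x_0^1),\dots,v_t^d(x^d|x_0^d)\big),\qquad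 x=(x^1,\dots,x^d),$$ which satisfies $\int_0^T\|v_t(\cdot|x_0)\|_{L_2(\mu_t)}^2\,\mathrm dt<\infty$ for all $T>0$, where $$v_t^i(x^i|x_0^i):=\begin{cases}\displaystyle (x^i-x_0^i)\Big(t+\frac{r_t(x^i-x_0^i)}{c}\cdot\frac{I_0(\beta r_t(x^i-x_0^i))}{I_0'(\beta r_t(x^i-x_0^i))}\Big)^{-1} & \text{if } x^i\in(x_0^i-ct,\,x_0^i+ct),\\ c & \text{if } x^i=x_0^i+ct,\\ -c & \text{if } x^i=x_0^i-ct,\\ \text{arbitrary (Borel measurable in } (t,x^i)\text{)} & \text{otherwise.}\end{cases}$$ Furthermore, for every $t>0$ and $i=1,\dots,d$, the path $s\mapsto X_s^i$ is almost surely differentiable at $t$, its derivative $\dot X^i(t)$ is integrable, and $$v_t^i(x^i|x_0^i)=\mathbb E\big[\dot X^i(t)\,\big|\,X_t^i=x^i,\;X_0^i=x_0^i\big]\qquad\text{for } P_{X_t^i}\text{-almost every } x^i.$$ -/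

import Mathlib

open MeasureTheory ProbabilityTheory Set
open scoped NNReal ENNReal

noncomputable section

namespace KacFlow

/-- The modified Bessel function of the first kind `I_k` of integer order `k`, on the real line,
`I_k(z) = ∑ₘ (z/2)^(2m+k) / (m! (m+k)!)`. -/
def besselI (k : ℕ) (z : ℝ) : ℝ :=
  ∑' m : ℕ, (z / 2) ^ (2 * m + k) / ((m.factorial : ℝ) * ((m + k).factorial : ℝ))

section KacPaths

variable {Ω : Type*} [MeasurableSpace Ω]

/-- `N` is a homogeneous Poisson point process on `[0, ∞)` with rate `a`: a counting process
(nondecreasing, right-continuous, `ℕ`-valued paths; the topology of `ℕ` is discrete) with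
`N(0) = 0`, independent increments, and `N(t) - N(s) ∼ Poi(a (t - s))`.
(The subtraction in `ℕ` is not truncated, since the paths are nondecreasing.) -/
structure IsPoissonProcess (a : ℝ) (N : ℝ≥0 → Ω → ℕ) (P : Measure Ω) : Prop where
  measurable : ∀ t, Measurable (N t)
  mono : ∀ ω, Monotone fun t => N t ω
  right_continuous : ∀ ω t, ContinuousWithinAt (fun s => N s ω) (Ici t) t
  zero : ∀ ω, N 0 ω = 0
  indep_increments : HasIndepIncrements N P
  law_increments : ∀ s t : ℝ≥0, s < t →
    P.map (fun ω => N t ω - N s ω) = poissonMeasure (Real.toNNReal (a * ((t : ℝ) - (s : ℝ))))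

/-- The random time `τ_t = ∫₀ᵗ (-1)^{N(s)} ds`, for `t ≥ 0`. -/
def randomTime (N : ℝ≥0 → Ω → ℕ) (t : ℝ) (ω : Ω) : ℝ :=
  ∫ s in (0 : ℝ)..t, (-1 : ℝ) ^ N s.toNNReal ω

/-- `K` is a one-dimensional Kac process starting in `0` with parameters `a`, `c`:
`K(t) = B c τ_t` for `t ≥ 0`, where `τ` is the random time of a Poisson process `N` of rate `a`
and `B` is a symmetric `±1`-valued random variable independent of the process `N`.
Only times `t ≥ 0` are meaningful. -/
def IsKacProcess (a c : ℝ) (K : ℝ → Ω → ℝ) (P : Measure Ω) : Prop :=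
  ∃ (B : Ω → ℝ) (N : ℝ≥0 → Ω → ℕ),
    Measurable B ∧
    P.map B = (2⁻¹ : ℝ≥0∞) • Measure.dirac (1 : ℝ) + (2⁻¹ : ℝ≥0∞) • Measure.dirac (-1 : ℝ) ∧
    IsPoissonProcess a N P ∧
    IndepFun B (fun ω (t : ℝ≥0) => N t ω) P ∧
    ∀ t : ℝ, 0 ≤ t → ∀ ω, K t ω = B ω * (c * randomTime N t ω)

/-- `K` is a `d`-dimensional Kac process starting in `0`: its components are one-dimensional Kac
processes with the same parameters `a`, `c` that are mutually independent as processes. -/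
structure IsMultiKacProcess {d : ℕ} (a c : ℝ) (K : ℝ → Ω → EuclideanSpace ℝ (Fin d))
    (P : Measure Ω) : Prop where
  component : ∀ i, IsKacProcess a c (fun t ω => K t ω i) P
  indep : iIndepFun (fun (i : Fin d) (ω : Ω) (t : ℝ≥0) => K (t : ℝ) ω i) P

end KacPaths

/-- `r_t(x) = √(c² t² - x²)`. -/
def radius (c t x : ℝ) : ℝ := Real.sqrt (c ^ 2 * t ^ 2 - x ^ 2)

/-- The one-dimensional velocity field `v_t(x | x₀)` of the Kac process started in `x₀`, with
`β = a / c`. The function `g` supplies the arbitrary values outside `[x₀ - ct, x₀ + ct]`. -/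
def kacVelocity (a c : ℝ) (g : ℝ × ℝ → ℝ) (x₀ t x : ℝ) : ℝ :=
  open scoped Classical in
  if x ∈ Ioo (x₀ - c * t) (x₀ + c * t) then
    (x - x₀) * (t + radius c t (x - x₀) / c *
      (besselI 0 (a / c * radius c t (x - x₀)) /
        deriv (besselI 0) (a / c * radius c t (x - x₀))))⁻¹
  else if x = x₀ + c * t then c
  else if x = x₀ - c * t then -c
  else g (t, x)

/-- The curve of measures `(μ_t)_{t ≥ 0}` and the velocity field `(v_t)_{t > 0}` satisfy the
continuity equation `∂_t μ_t + ∇·(μ_t v_t) = 0`: `μ` is a narrowly continuous curve of probability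
measures with finite second moments, `v` is a Borel vector field with
`‖v_t‖_{L²(μ_t)} ∈ L²(0, T)` for all `T`, and the equation holds in the sense of distributions on
`(0, ∞) × ℝᵈ`, i.e. against every smooth `φ` with compact support in `(0, ∞) × ℝᵈ`. -/
structure SatisfiesContinuityEquation {d : ℕ} (μ : ℝ → Measure (EuclideanSpace ℝ (Fin d)))
    (v : ℝ → EuclideanSpace ℝ (Fin d) → EuclideanSpace ℝ (Fin d)) : Prop where
  isProbabilityMeasure : ∀ t, 0 ≤ t → IsProbabilityMeasure (μ t)
  second_moment : ∀ t, 0 ≤ t → MemLp id 2 (μ t)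
  narrowly_continuous : ∀ f : BoundedContinuousFunction (EuclideanSpace ℝ (Fin d)) ℝ,
    ContinuousOn (fun t => ∫ x, f x ∂μ t) (Ici 0)
  measurable_velocity : Measurable fun p : ℝ × EuclideanSpace ℝ (Fin d) => v p.1 p.2
  velocity_bound : ∀ T : ℝ, ∫⁻ t in Ioo 0 T, ∫⁻ x, ‖v t x‖ₑ ^ 2 ∂μ t < ⊤
  equation : ∀ φ : ℝ × EuclideanSpace ℝ (Fin d) → ℝ, ContDiff ℝ ((⊤ : ℕ∞) : WithTop ℕ∞) φ → HasCompactSupport φ →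
    tsupport φ ⊆ Ioi 0 ×ˢ univ →
    ∫ t in Ioi (0 : ℝ), ∫ x, (deriv (fun s => φ (s, x)) t
      + inner ℝ (gradient (fun y => φ (t, y)) x) (v t x)) ∂μ t = 0

end KacFlow

end

namespace KacFlow

open Filter Topology

/-! Along a path, the time integral of the derivative of φ(t, X t) is a boundary term, which is zero
for a test function. Taking expectations and replacing the direction of motion by its conditional
mean given the position gives the weak continuity equation. What remains is to identify this
conditional mean with the Bessel quotient in `kacVelocity`.

Let U be the time in [0, t] that N spends at even values, so that τ_t = 2U - t. On {N t = n} with n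
≥ 1, U has a Beta(⌊n/2⌋ + 1, ⌈n/2⌉) law stretched to [0, t], weighted by P(N t = n): `moment`
computes its moments by induction, and `measure_eq_of_moments` turns them into the density
`jumpDensity`. Without jumps U = t. With y = 2u - t, summing over odd n gives I₀ and over even n ≥ 2
gives I₁ = I₀', both at a√(t² - y²). Averaging over the sign B adds the mirror image u ↦ t - u, and
the velocity is exactly the value that balances the two contributions (`tsum_jumpDensity_reflect`).
The event without jumps is the atom at ±ct, where the velocity is ±c. This gives
`integral_odd_mul_direction_sub` and, with the sign, `integral_mul_velocity_sub`.

In dimension d the direction of a component is a function of the path of that component, hence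
independent of the other components; conditioning on the whole position therefore reduces to one
coordinate (`integral_mul_direction_sub_velocity`). Both the continuity equation and `condExp_deriv`
follow from this. -/

/-- A process with right-continuous `ℕ`-valued paths is jointly measurable. -/
theorem measurable_uncurry_of_rightContinuous {Ω : Type*} {m : MeasurableSpace Ω}
    {Y : ℝ≥0 → Ω → ℕ} (hY : ∀ t, Measurable (Y t))
    (hr : ∀ ω t, ContinuousWithinAt (fun s => Y s ω) (Ici t) t) :
    Measurable fun p : ℝ≥0 × Ω => Y p.1 p.2 := by
  obtain ⟨j, hj⟩ : ∃ j : ℕ → ℝ≥0 → ℕ, ∀ n t, j n t = ⌊((n : ℝ≥0) + 1) * t⌋₊ :=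
    ⟨_, fun _ _ => rfl⟩
  have hjm : ∀ n, Measurable (j n) := fun n => by
    have : j n = fun t => ⌊((n : ℝ≥0) + 1) * t⌋₊ := funext (hj n)
    rw [this]
    exact Nat.measurable_floor.comp (measurable_id.const_mul _)
  -- `q n t` is the first point strictly to the right of t on the grid of mesh 1/(n+1): it takes
  -- countably many values and approaches t from the side on which the paths are continuous.
  let q : ℕ → ℝ≥0 → ℝ≥0 := fun n t => ((j n t : ℝ≥0) + 1) / ((n : ℝ≥0) + 1)
  have hq_ge : ∀ n t, t ≤ q n t := fun n t => by
    rw [le_div_iff₀ (by positivity), mul_comm, hj]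
    exact (Nat.lt_floor_add_one _).le
  have hq_le : ∀ n t, q n t ≤ t + 1 / ((n : ℝ≥0) + 1) := fun n t => by
    have : t + 1 / ((n : ℝ≥0) + 1) = (((n : ℝ≥0) + 1) * t + 1) / ((n : ℝ≥0) + 1) := by
      field_simp
    rw [this]
    have := Nat.floor_le (zero_le (a := ((n : ℝ≥0) + 1) * t))
    simp only [q, hj]
    gcongr
  have hq : ∀ t, Tendsto (fun n => q n t) atTop (𝓝[≥] t) := fun t => by
    refine tendsto_nhdsWithin_iff.2 ⟨?_, Eventually.of_forall fun n => hq_ge n t⟩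
    refine tendsto_of_tendsto_of_tendsto_of_le_of_le tendsto_const_nhds ?_
      (fun n => hq_ge n t) (fun n => hq_le n t)
    have : Tendsto (fun n : ℕ => t + 1 / ((n : ℝ≥0) + 1)) atTop (𝓝 (t + 0)) :=
      tendsto_const_nhds.add tendsto_one_div_add_atTop_nhds_zero_nat
    simpa using this
  refine measurable_of_tendsto_metrizable (f := fun n (p : ℝ≥0 × Ω) => Y (q n p.1) p.2)
    (fun n => ?_) ?_
  · have h1 : Measurable fun p : ℕ × Ω => Y (((p.1 : ℝ≥0) + 1) / ((n : ℝ≥0) + 1)) p.2 :=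
      measurable_from_prod_countable_right fun k => hY (((k : ℝ≥0) + 1) / ((n : ℝ≥0) + 1))
    have h2 : Measurable fun p : ℝ≥0 × Ω => (j n p.1, p.2) :=
      ((hjm n).comp measurable_fst).prodMk measurable_snd
    have h3 : (fun p : ℝ≥0 × Ω => Y (q n p.1) p.2) =
        (fun p : ℕ × Ω => Y (((p.1 : ℝ≥0) + 1) / ((n : ℝ≥0) + 1)) p.2) ∘
          fun p : ℝ≥0 × Ω => (j n p.1, p.2) := rfl
    rw [h3]
    exact Measurable.comp h1 h2
  · rw [tendsto_pi_nhds]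
    exact fun p => (hr p.2 p.1).tendsto.comp (hq p.1)

/-! ### Poisson processes: independence of the past and the next increment. -/

section Poisson

variable {Ω : Type*} [MeasurableSpace Ω] {a : ℝ} {N : ℝ≥0 → Ω → ℕ} {P : Measure Ω}

/-- The information available from a process up to time `s`. -/
@[reducible]
def past {Ω : Type*} (N : ℝ≥0 → Ω → ℕ) (s : ℝ≥0) : MeasurableSpace Ω :=
  ⨆ r : Iic s, MeasurableSpace.comap (N r) inferInstance

theorem measurable_past {Ω : Type*} {N : ℝ≥0 → Ω → ℕ} {r s : ℝ≥0} (h : r ≤ s) : Measurable[past N s] (N r) :=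
  Measurable.mono (comap_measurable _)
    (le_iSup (fun r : Iic s => MeasurableSpace.comap (N r) inferInstance) ⟨r, h⟩) le_rfl

theorem IsPoissonProcess.past_le (hN : IsPoissonProcess a N P) (s : ℝ≥0) :
    past N s ≤ ‹MeasurableSpace Ω› :=
  iSup_le fun r => (hN.measurable r).comap_le

/-- Along a monotone sequence of times starting at `0`, the values up to time `τ n` are
independent of the next increment. -/
theorem IsPoissonProcess.indep_of_monotone [IsProbabilityMeasure P]
    (hN : IsPoissonProcess a N P) {τ : ℕ → ℝ≥0}
    (hτ : Monotone τ) (h0 : τ 0 = 0) (n : ℕ) :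
    Indep (⨆ k : Iic n, MeasurableSpace.comap (N (τ k)) inferInstance)
      (MeasurableSpace.comap (fun ω => N (τ (n + 1)) ω - N (τ n) ω) inferInstance) P := by
  have hi := hN.indep_increments.nat hτ
  have hm : ∀ i, Measurable fun ω => N (τ (i + 1)) ω - N (τ i) ω := fun i =>
    (hN.measurable _).sub (hN.measurable _)
  have h := hi.indepFun_finset (Finset.range n) {n} (by simp) hm
  have h' := h.comp measurable_id (measurable_pi_apply (⟨n, by simp⟩ : ({n} : Finset ℕ)))
  refine indep_of_indep_of_le_left h' (iSup_le fun k => ?_)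
  -- Each earlier value is a telescoping sum of earlier increments. This starts from N 0 = 0, and
  -- the paths being monotone keeps the subtraction in ℕ exact.
  have key : ∀ k ≤ n, ∀ ω, N (τ k) ω = ∑ i : Finset.range n,
      if i.1 < k then N (τ (i.1 + 1)) ω - N (τ i.1) ω else 0 := by
    intro k hk ω
    rw [Finset.sum_coe_sort (Finset.range n)
      (fun i => if i < k then N (τ (i + 1)) ω - N (τ i) ω else 0), ← Finset.sum_filter]
    have : (Finset.range n).filter (fun i => i < k) = Finset.range k := by
      ext i; simp; omega
    rw [this, Finset.sum_range_tsub (f := fun i => N (τ i) ω)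
      (fun i j hij => hN.mono ω (hτ hij)), h0, hN.zero, Nat.sub_zero]
  have e : N (τ k) = (fun x : (Finset.range n) → ℕ => ∑ i, if i.1 < k.1 then x i else 0) ∘
      (id ∘ fun ω (i : Finset.range n) => N (τ (i.1 + 1)) ω - N (τ i.1) ω) := by
    ext ω; exact key k k.2 ω
  rw [e, ← MeasurableSpace.comap_comp]
  refine MeasurableSpace.comap_mono (Measurable.comap_le ?_)
  refine Finset.measurable_sum _ fun i _ => ?_
  split_ifs
  · exact measurable_pi_apply i
  · exact measurable_const

/-- The increment of a Poisson process after time `s` is independent of the past. -/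
theorem IsPoissonProcess.indep_past [IsProbabilityMeasure P] (hN : IsPoissonProcess a N P)
    {s t : ℝ≥0} (hst : s ≤ t) :
    Indep (past N s) (MeasurableSpace.comap (fun ω => N t ω - N s ω) inferInstance) P := by
  -- The past is a directed union over finite sets of times, and independence passes to such unions.
  have e : past N s = ⨆ S : Finset (Iic s), ⨆ r ∈ S,
      MeasurableSpace.comap (N (r : Iic s)) inferInstance := by
    unfold past
    exact iSup_eq_iSup_finset _
  rw [e]
  refine indep_iSup_of_directed_le (fun S => ?_)
    (fun S => iSup₂_le fun r _ => (hN.measurable r).comap_le)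
    ((hN.measurable t).sub (hN.measurable s)).comap_le
    (Monotone.directed_le fun S T hST => biSup_mono fun r hr => Finset.mem_of_subset hST hr)
  let n := S.card
  -- The times are 0, then the n points of `S` in increasing order at indices 1, …, n, then s at n +
  -- 1, and t from there on.
  let τ : ℕ → ℝ≥0 := fun k => if k = 0 then 0 else if h : k - 1 < n then
    (S.orderEmbOfFin rfl ⟨k - 1, h⟩ : Iic s) else if k = n + 1 then s else t
  have hτ : Monotone τ := by
    refine monotone_nat_of_le_succ fun k => ?_
    simp only [τ]
    by_cases h0 : k = 0
    · simp [h0]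
    rw [if_neg h0, if_neg (Nat.succ_ne_zero k)]
    by_cases h1 : k + 1 - 1 < n
    · have h2 : k - 1 < n := by omega
      rw [dif_pos h1, dif_pos h2]
      refine Subtype.coe_le_coe.2 ((S.orderEmbOfFin rfl).monotone ?_)
      simp
    · rw [dif_neg h1]
      by_cases h2 : k - 1 < n
      · rw [dif_pos h2, if_pos (by omega)]
        exact (S.orderEmbOfFin rfl ⟨k - 1, h2⟩).2
      · rw [dif_neg h2]
        split_ifs <;> first | exact le_rfl | exact hst | omega
  have h := hN.indep_of_monotone hτ (by simp [τ]) (n + 1)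
  have e1 : τ (n + 1) = s := by simp [τ]
  have e2 : τ (n + 1 + 1) = t := by simp [τ]
  rw [e1, e2] at h
  refine indep_of_indep_of_le_left h (iSup₂_le fun r hr => ?_)
  have : r ∈ Set.range (S.orderEmbOfFin rfl) := by simpa using hr
  obtain ⟨k, hk⟩ := this
  have e3 : τ (k + 1) = r := by
    have : k.1 < n := k.2
    simp [τ, this, hk]
  rw [← e3]
  exact le_iSup (fun k : Iic (n + 1) => MeasurableSpace.comap (N (τ k)) inferInstance)
    ⟨k.1 + 1, by simp; exact k.2.le⟩

end Poisson

/-! ### Beta integrals and factorial sums. -/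

/-- Integration by parts moves one degree from t - s to s. Both boundary terms vanish, so the value
depends on p + q only. -/
theorem integral_pow_div_factorial_mul (p q : ℕ) (t : ℝ) :
    ∫ s in (0 : ℝ)..t, s ^ p / p.factorial * ((t - s) ^ q / q.factorial) =
      t ^ (p + q + 1) / (p + q + 1).factorial := by
  induction q generalizing p with
  | zero =>
    simp only [pow_zero, Nat.factorial_zero, Nat.cast_one, div_one, mul_one, add_zero]
    rw [intervalIntegral.integral_div, integral_pow, Nat.factorial_succ]
    push_cast
    have : (p.factorial : ℝ) ≠ 0 := by positivity
    field_simp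
    simp
  | succ q ih =>
    have hd : ∀ s : ℝ, HasDerivAt
        (fun s : ℝ => s ^ (p + 1) / (p + 1).factorial * ((t - s) ^ (q + 1) / (q + 1).factorial))
        (s ^ p / p.factorial * ((t - s) ^ (q + 1) / (q + 1).factorial) -
          s ^ (p + 1) / (p + 1).factorial * ((t - s) ^ q / q.factorial)) s := by
      intro s
      have h1 := ((hasDerivAt_id s).pow (p + 1)).div_const ((p + 1).factorial : ℝ)
      have h2 := (((hasDerivAt_id s).const_sub t).pow (q + 1)).div_const ((q + 1).factorial : ℝ)
      convert! h1.mul h2 using 1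
      simp only [Nat.factorial_succ, id, Pi.pow_apply]
      push_cast
      have hp : (p.factorial : ℝ) ≠ 0 := by positivity
      have hq : (q.factorial : ℝ) ≠ 0 := by positivity
      field_simp
      ring
    have h := intervalIntegral.integral_eq_sub_of_hasDerivAt (a := 0) (b := t)
      (fun s _ => hd s) (Continuous.intervalIntegrable (by fun_prop) _ _)
    rw [intervalIntegral.integral_sub (Continuous.intervalIntegrable (by fun_prop) _ _)
      (Continuous.intervalIntegrable (by fun_prop) _ _), ih (p + 1)] at h
    simp only [sub_self, ne_eq, Nat.succ_ne_zero, not_false_eq_true, zero_pow, zero_div, mul_zero,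
      zero_mul] at h
    rw [sub_eq_zero.1 h]
    congr 2
    · ring
    · congr 2; ring

/-- This is the hockey-stick identity for binomial coefficients, multiplied by (m + 1)!. -/
theorem sum_range_factorial_div (m i : ℕ) :
    ((m : ℝ) + 1) * ∑ j ∈ Finset.range (i + 1), ((m + j).factorial : ℝ) / j.factorial =
      ((m + 1 + i).factorial : ℝ) / i.factorial := by
  induction i with
  | zero => simp [Nat.factorial_succ]
  | succ i ih =>
    rw [Finset.sum_range_succ, mul_add, ih]
    have : m + 1 + (i + 1) = (m + 1 + i) + 1 := by ring
    rw [this, show m + (i + 1) = m + 1 + i by ring, Nat.factorial_succ (m + 1 + i),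
      Nat.factorial_succ i]
    have h : (i.factorial : ℝ) ≠ 0 := by positivity
    push_cast
    field_simp
    ring

theorem sum_range_even {M : Type*} [AddCommMonoid M] (f : ℕ → M) (n : ℕ) :
    ∑ k ∈ Finset.range (n + 1), (if Even k then f (k / 2) else 0) =
      ∑ j ∈ Finset.range (n / 2 + 1), f j := by
  induction n with
  | zero => simp
  | succ n ih =>
    rw [Finset.sum_range_succ, ih]
    split_ifs with h
    · have : (n + 1) / 2 = n / 2 + 1 := by grind
      rw [this, Finset.sum_range_succ _ (n / 2 + 1)]
    · have : (n + 1) / 2 = n / 2 := by grind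
      rw [this, add_zero]

/-! ### Time integrals along a path of the Poisson process. -/

section Poisson

variable {Ω : Type*} [MeasurableSpace Ω] {a : ℝ} {N : ℝ≥0 → Ω → ℕ} {P : Measure Ω}

/-- The time integral over `[0, t]` of a function `h` of the state of the process. -/
noncomputable def primitive {Ω : Type*} (h : ℕ → ℝ) (N : ℝ≥0 → Ω → ℕ) (t : ℝ) (ω : Ω) : ℝ :=
  ∫ s in (0 : ℝ)..t, h (N s.toNNReal ω)

namespace IsPoissonProcess

theorem measurable_uncurry (hN : IsPoissonProcess a N P) :
    Measurable fun p : ℝ × Ω => N p.1.toNNReal p.2 :=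
  (measurable_uncurry_of_rightContinuous hN.measurable hN.right_continuous).comp
    ((measurable_real_toNNReal.comp measurable_fst).prodMk measurable_snd)

theorem measurable_path (hN : IsPoissonProcess a N P) (ω : Ω) :
    Measurable fun s : ℝ => N s.toNNReal ω :=
  hN.measurable_uncurry.comp (measurable_id.prodMk measurable_const)

theorem intervalIntegrable (hN : IsPoissonProcess a N P) {h : ℕ → ℝ} {C : ℝ}
    (hC : ∀ n, |h n| ≤ C) (ω : Ω) (s t : ℝ) :
    IntervalIntegrable (fun s : ℝ => h (N s.toNNReal ω)) volume s t := by
  refine (intervalIntegrable_const (c := C)).mono_fun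
    (Measurable.of_discrete.comp (hN.measurable_path ω)).aestronglyMeasurable ?_
  refine Eventually.of_forall fun s => ?_
  exact (hC _).trans (le_abs_self C)

theorem continuousWithinAt (hN : IsPoissonProcess a N P) (h : ℕ → ℝ) (ω : Ω) (t : ℝ) :
    ContinuousWithinAt (fun s : ℝ => h (N s.toNNReal ω)) (Ici t) t := by
  have h1 : ContinuousWithinAt (fun s : ℝ => N s.toNNReal ω) (Ici t) t :=
    (hN.right_continuous ω t.toNNReal).comp continuous_real_toNNReal.continuousWithinAt
      fun s hs => Real.toNNReal_le_toNNReal hs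
  exact (continuous_of_discreteTopology (f := h)).continuousAt.comp_continuousWithinAt h1

theorem hasDerivWithinAt_primitive (hN : IsPoissonProcess a N P) {h : ℕ → ℝ} {C : ℝ}
    (hC : ∀ n, |h n| ≤ C) (ω : Ω) (t : ℝ) :
    HasDerivWithinAt (fun t => primitive h N t ω) (h (N t.toNNReal ω)) (Ici t) t :=
  intervalIntegral.integral_hasDerivWithinAt_right (hN.intervalIntegrable hC ω _ _)
    ((Measurable.of_discrete.comp
      (hN.measurable_path ω)).stronglyMeasurable.stronglyMeasurableAtFilter)
    ((hN.continuousWithinAt h ω t).mono Ioi_subset_Ici_self)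

theorem continuous_primitive (hN : IsPoissonProcess a N P) {h : ℕ → ℝ} {C : ℝ}
    (hC : ∀ n, |h n| ≤ C) (ω : Ω) : Continuous fun t => primitive h N t ω :=
  intervalIntegral.continuous_primitive (fun s t => hN.intervalIntegrable hC ω s t) 0

theorem abs_primitive_le {Ω : Type*} {N : ℝ≥0 → Ω → ℕ} {h : ℕ → ℝ} {C : ℝ}
    (hC : ∀ n, |h n| ≤ C) (ω : Ω) {t : ℝ} (ht : 0 ≤ t) :
    |primitive h N t ω| ≤ C * t := by
  have := intervalIntegral.norm_integral_le_of_norm_le_const (a := 0) (b := t)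
    (f := fun s : ℝ => h (N s.toNNReal ω)) (C := C) fun s _ => hC _
  rwa [sub_zero, abs_of_nonneg ht] at this

/-- This makes the time integral up to t independent of later increments. Freezing the process at
time t makes the integrand jointly measurable with respect to the past. -/
theorem measurable_primitive_past (hN : IsPoissonProcess a N P) (h : ℕ → ℝ) {t : ℝ}
    (ht : 0 ≤ t) : Measurable[past N t.toNNReal] (primitive h N t) := by
  have h1 : @Measurable (ℝ≥0 × Ω) ℕ (@Prod.instMeasurableSpace _ _ _ (past N t.toNNReal)) _
      fun p : ℝ≥0 × Ω => N (min p.1 t.toNNReal) p.2 := by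
    refine @measurable_uncurry_of_rightContinuous Ω (past N t.toNNReal)
      (fun s ω => N (min s t.toNNReal) ω) (fun s => measurable_past (min_le_right _ _))
      fun ω s => ?_
    exact (hN.right_continuous ω (min s t.toNNReal)).comp
      (f := fun s => min s t.toNNReal) (by fun_prop)
      fun r hr => mem_Ici.2 (min_le_min_right _ (mem_Ici.1 hr))
  have h2 : primitive h N t =
      fun ω => ∫ s in Ioc 0 t, h (N (min s.toNNReal t.toNNReal) ω) := by
    ext ω
    rw [primitive, intervalIntegral.integral_of_le ht]
    refine setIntegral_congr_fun measurableSet_Ioc fun s hs => ?_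
    rw [min_eq_left (Real.toNNReal_le_toNNReal hs.2)]
  rw [h2]
  have h3 : @Measurable (Ω × ℝ) ℝ (@Prod.instMeasurableSpace _ _ (past N t.toNNReal) _) _
      fun p : Ω × ℝ => h (N (min p.2.toNNReal t.toNNReal) p.1) := by
    let _ := past N t.toNNReal
    exact Measurable.of_discrete.comp (h1.comp
      ((measurable_real_toNNReal.comp measurable_snd).prodMk measurable_fst))
  let _ := past N t.toNNReal
  exact (h3.stronglyMeasurable.integral_prod_right').measurable

theorem measurable_primitive (hN : IsPoissonProcess a N P) (h : ℕ → ℝ) {t : ℝ}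
    (ht : 0 ≤ t) : Measurable (primitive h N t) :=
  (hN.measurable_primitive_past h ht).mono (hN.past_le _) le_rfl

theorem measurable_primitive_of_real (hN : IsPoissonProcess a N P) (h : ℕ → ℝ) (t : ℝ) :
    Measurable (primitive h N t) := by
  rcases le_total 0 t with ht | ht
  · exact hN.measurable_primitive h ht
  -- For negative times `Real.toNNReal` freezes the process in its initial state 0.
  · have : primitive h N t = fun _ => t * h 0 := by
      ext ω
      rw [primitive, intervalIntegral.integral_congr (g := fun _ => h 0)]
      · simp
      · intro s hs
        rw [uIcc_of_ge ht] at hs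
        simp [Real.toNNReal_of_nonpos hs.2, hN.zero]
    rw [this]
    exact measurable_const

theorem measurable_uncurry_primitive (hN : IsPoissonProcess a N P) {h : ℕ → ℝ} {C : ℝ}
    (hC : ∀ n, |h n| ≤ C) : Measurable fun p : ℝ × Ω => primitive h N p.1 p.2 :=
  measurable_uncurry_of_continuous_of_measurable (u := primitive h N)
    (fun ω => hN.continuous_primitive hC ω) (fun t => hN.measurable_primitive_of_real h t)

end IsPoissonProcess

end Poisson

/-! ### Moments of the time spent in even states. -/

/-- The indicator of the even numbers. -/
noncomputable def evenInd (n : ℕ) : ℝ := if Even n then 1 else 0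

theorem abs_evenInd_le (n : ℕ) : |evenInd n| ≤ 1 := by
  unfold evenInd; split_ifs <;> simp

namespace IsPoissonProcess

variable {Ω : Type*} [MeasurableSpace Ω] {a : ℝ} {N : ℝ≥0 → Ω → ℕ} {P : Measure Ω}

/-- The fundamental theorem of calculus is used with right derivatives, since the integrand jumps.
-/
theorem primitive_pow_succ (hN : IsPoissonProcess a N P) {h : ℕ → ℝ} {C : ℝ}
    (hC : ∀ n, |h n| ≤ C) (m : ℕ) {t : ℝ} (ht : 0 ≤ t) (ω : Ω) :
    primitive h N t ω ^ (m + 1) =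
      (m + 1) * ∫ r in Ioc 0 t, primitive h N r ω ^ m * h (N r.toNNReal ω) := by
  have h1 := intervalIntegral.integral_eq_sub_of_hasDeriv_right_of_le (a := 0) (b := t) ht
    (f := fun r => primitive h N r ω ^ (m + 1))
    (f' := fun r => (m + 1) * (primitive h N r ω ^ m * h (N r.toNNReal ω)))
    ((hN.continuous_primitive hC ω).pow _).continuousOn
    (fun r _ => by
      convert! ((hN.hasDerivWithinAt_primitive hC ω r).mono Ioi_subset_Ici_self).pow (m + 1)
        using 1
      push_cast
      ring)
    (((hN.intervalIntegrable hC ω 0 t).continuousOn_mul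
      ((hN.continuous_primitive hC ω).pow m).continuousOn).const_mul _)
  have h0 : primitive h N 0 ω = 0 := by simp [primitive]
  rw [h0] at h1
  rw [← intervalIntegral.integral_of_le ht, ← intervalIntegral.integral_const_mul, h1]
  simp

theorem integral_increment [IsProbabilityMeasure P] (ha : 0 < a) (hN : IsPoissonProcess a N P)
    {s t : ℝ} (hs : 0 ≤ s) (hst : s < t) (n : ℕ) :
    ∫ ω, (if N t.toNNReal ω - N s.toNNReal ω = n then (1 : ℝ) else 0) ∂P =
      Real.exp (-(a * (t - s))) * ((a * (t - s)) ^ n / n.factorial) := by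
  have h := hN.law_increments s.toNNReal t.toNNReal
    ((Real.toNNReal_lt_toNNReal_iff (hs.trans_lt hst)).2 hst)
  have hm : Measurable fun ω => N t.toNNReal ω - N s.toNNReal ω :=
    (hN.measurable _).sub (hN.measurable _)
  have e : (fun ω => if N t.toNNReal ω - N s.toNNReal ω = n then (1 : ℝ) else 0) =
      ((fun ω => N t.toNNReal ω - N s.toNNReal ω) ⁻¹' {n}).indicator 1 := by
    funext ω
    by_cases hω : N t.toNNReal ω - N s.toNNReal ω = n
    · rw [if_pos hω, Set.indicator_of_mem (show ω ∈ _ from hω), Pi.one_apply]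
    · rw [if_neg hω, Set.indicator_of_notMem (show ω ∉ _ from hω)]
  rw [e, integral_indicator_one (hm (measurableSet_singleton n)), measureReal_def,
    ← Measure.map_apply hm (measurableSet_singleton n), h, ← measureReal_def,
    poissonMeasure_real_singleton, Real.coe_toNNReal t (hs.trans hst.le), Real.coe_toNNReal s hs,
    Real.coe_toNNReal _ (by have := sub_pos.2 hst; positivity)]
  ring

theorem integral_jump_count [IsProbabilityMeasure P] (ha : 0 < a)
    (hN : IsPoissonProcess a N P) {t : ℝ} (ht : 0 ≤ t) (n : ℕ) :
    ∫ ω, (if N t.toNNReal ω = n then (1 : ℝ) else 0) ∂P =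
      Real.exp (-(a * t)) * ((a * t) ^ n / n.factorial) := by
  rcases ht.eq_or_lt with rfl | ht
  · rcases n with _ | n <;> simp [hN.zero]
  · have := hN.integral_increment ha le_rfl ht n
    simpa [hN.zero] using this

/-- Splitting the number of jumps up to time `t` at an earlier time `r`. -/
theorem evenInd_mul_ite (hN : IsPoissonProcess a N P) {r t : ℝ≥0} (h : r ≤ t) (n : ℕ) (ω : Ω) :
    evenInd (N r ω) * (if N t ω = n then (1 : ℝ) else 0) =
      ∑ k ∈ Finset.range (n + 1), if Even k then
        (if N r ω = k then (1 : ℝ) else 0) * (if N t ω - N r ω = n - k then 1 else 0) else 0 := by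
  have hm : N r ω ≤ N t ω := hN.mono ω h
  by_cases hn : N t ω = n
  · rw [Finset.sum_eq_single (N r ω)]
    · simp [evenInd, hn]
    · intro k _ hk
      simp [Ne.symm hk]
    · intro hk
      exact absurd (Finset.mem_range.2 (by omega)) hk
  · rw [if_neg hn, mul_zero, Finset.sum_eq_zero]
    intro k hk
    have hk' := Finset.mem_range.1 hk
    split_ifs <;> first | omega | simp

/-- The moments of the time spent in even states, on the event of exactly `n` jumps. -/
theorem moment [IsProbabilityMeasure P] (ha : 0 < a) (hN : IsPoissonProcess a N P) (m n : ℕ)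
    {t : ℝ} (ht : 0 ≤ t) :
    ∫ ω, primitive evenInd N t ω ^ m * (if N t.toNNReal ω = n then (1 : ℝ) else 0) ∂P =
      Real.exp (-(a * t)) * a ^ n * (t ^ (n + m) / (n + m).factorial) *
        ((m + n / 2).factorial / (n / 2).factorial) := by
  -- The induction hypothesis is needed at every intermediate time r and every number k of jumps
  -- before r.
  induction m generalizing n t with
  | zero =>
    simp only [pow_zero, one_mul, zero_add, add_zero]
    rw [hN.integral_jump_count ha ht, div_self (by positivity), mul_pow]
    ring
  | succ m ih =>
    have hpm : Measurable fun p : Ω × ℝ => primitive evenInd N p.2 p.1 :=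
      (hN.measurable_uncurry_primitive abs_evenInd_le).comp measurable_swap
    have hNm : Measurable fun p : Ω × ℝ => N p.2.toNNReal p.1 :=
      hN.measurable_uncurry.comp measurable_swap
    have hite : ∀ (k : ℕ) (s : ℝ), Measurable fun ω => if N s.toNNReal ω = k then (1 : ℝ) else 0 :=
      fun k s => (Measurable.of_discrete (f := fun j : ℕ => if j = k then (1 : ℝ) else 0)).comp
        (hN.measurable s.toNNReal)
    have hpow : ∀ r ∈ Ioc 0 t, ∀ ω, |primitive evenInd N r ω ^ m| ≤ t ^ m := fun r hr ω => by
      rw [abs_pow]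
      refine pow_le_pow_left₀ (abs_nonneg _) ?_ m
      exact (abs_primitive_le abs_evenInd_le ω hr.1.le).trans (by simpa using hr.2)
    have hint : ∀ (k : ℕ) (r : ℝ), r ∈ Ioc 0 t → Integrable (fun ω =>
        primitive evenInd N r ω ^ m * if N r.toNNReal ω = k then (1 : ℝ) else 0) P :=
      fun k r hr => by
        refine Integrable.of_bound (C := t ^ m) (((hN.measurable_primitive evenInd
          hr.1.le).pow_const m).mul (hite k r)).aestronglyMeasurable
          (Eventually.of_forall fun ω => ?_)
        rw [norm_mul, Real.norm_eq_abs]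
        have := hpow r hr ω
        split_ifs
        · simpa using this
        · simpa using (abs_nonneg _).trans this
    -- Split by the number k of jumps up to r, which must be even. The factor at time r belongs to
    -- the past, and the remaining n - k jumps are independent of it.
    have key : ∀ r ∈ Ioo 0 t, ∫ ω, primitive evenInd N r ω ^ m * evenInd (N r.toNNReal ω) *
          (if N t.toNNReal ω = n then (1 : ℝ) else 0) ∂P =
        ∑ k ∈ Finset.range (n + 1), if Even k then Real.exp (-(a * t)) * a ^ n *
          ((m + k / 2).factorial / (k / 2).factorial) *
          (r ^ (k + m) / (k + m).factorial * ((t - r) ^ (n - k) / (n - k).factorial)) else 0 := by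
      intro r hr
      have hr' : r ∈ Ioc 0 t := Ioo_subset_Ioc_self hr
      have hrt : r.toNNReal ≤ t.toNNReal := Real.toNNReal_le_toNNReal hr.2.le
      have e : ∀ ω, primitive evenInd N r ω ^ m * evenInd (N r.toNNReal ω) *
          (if N t.toNNReal ω = n then (1 : ℝ) else 0) =
          ∑ k ∈ Finset.range (n + 1), if Even k then
            (primitive evenInd N r ω ^ m * if N r.toNNReal ω = k then (1 : ℝ) else 0) *
            (if N t.toNNReal ω - N r.toNNReal ω = n - k then 1 else 0) else 0 := fun ω => by
        rw [mul_assoc, hN.evenInd_mul_ite hrt, Finset.mul_sum]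
        refine Finset.sum_congr rfl fun k _ => ?_
        split_ifs <;> simp
      have hindep : ∀ k, IndepFun
          (fun ω => primitive evenInd N r ω ^ m * if N r.toNNReal ω = k then (1 : ℝ) else 0)
          (fun ω => if N t.toNNReal ω - N r.toNNReal ω = n - k then (1 : ℝ) else 0) P := by
        intro k
        have h1 := hN.indep_past hrt
        refine indep_of_indep_of_le_left (indep_of_indep_of_le_right h1 ?_) ?_
        · refine Measurable.comap_le ?_
          exact (Measurable.of_discrete (f := fun j : ℕ => if j = n - k then (1 : ℝ) else 0)).comp
            (comap_measurable _)
        · refine Measurable.comap_le ?_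
          refine ((hN.measurable_primitive_past evenInd hr.1.le).pow_const m).mul ?_
          exact (Measurable.of_discrete (f := fun j : ℕ => if j = k then (1 : ℝ) else 0)).comp
            (measurable_past le_rfl)
      have hm2 : ∀ k, Measurable fun ω =>
          if N t.toNNReal ω - N r.toNNReal ω = n - k then (1 : ℝ) else 0 := fun k =>
        (Measurable.of_discrete (f := fun j : ℕ => if j = n - k then (1 : ℝ) else 0)).comp
          ((hN.measurable _).sub (hN.measurable _))
      simp_rw [e]
      rw [integral_finsetSum]
      · refine Finset.sum_congr rfl fun k hk => ?_
        have hk' := Nat.lt_succ_iff.1 (Finset.mem_range.1 hk)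
        split_ifs with hev
        · rw [(hindep k).integral_fun_mul_eq_mul_integral (hint k r hr').aestronglyMeasurable
            (hm2 k).aestronglyMeasurable, ih k hr.1.le,
            hN.integral_increment ha hr.1.le hr.2, mul_pow]
          have e1 : Real.exp (-(a * t)) = Real.exp (-(a * r)) * Real.exp (-(a * (t - r))) := by
            rw [← Real.exp_add]; congr 1; ring
          have e2 : a ^ n = a ^ k * a ^ (n - k) := by rw [← pow_add]; congr 1; omega
          rw [e1, e2]
          ring
        · simp
      · intro k _
        split_ifs
        · refine (hint k r hr').mul_bdd (c := 1) (hm2 k).aestronglyMeasurable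
            (Eventually.of_forall fun ω => ?_)
          split_ifs <;> simp
        · exact integrable_zero _ _ _
    have hswap : ∫ ω, primitive evenInd N t ω ^ (m + 1) *
          (if N t.toNNReal ω = n then (1 : ℝ) else 0) ∂P =
        (m + 1) * ∫ r in Ioo 0 t, ∫ ω, primitive evenInd N r ω ^ m * evenInd (N r.toNNReal ω) *
          (if N t.toNNReal ω = n then (1 : ℝ) else 0) ∂P := by
      simp_rw [hN.primitive_pow_succ abs_evenInd_le m ht, mul_assoc, integral_Ioc_eq_integral_Ioo]
      rw [integral_const_mul]
      congr 1
      simp_rw [← integral_mul_const]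
      rw [integral_integral_swap]
      · simp_rw [mul_assoc]
      · refine Integrable.of_bound (C := t ^ m) ?_ ?_
        · have h1 : Measurable fun p : Ω × ℝ => evenInd (N p.2.toNNReal p.1) :=
            (Measurable.of_discrete (f := evenInd)).comp hNm
          have h2 : Measurable fun p : Ω × ℝ => if N t.toNNReal p.1 = n then (1 : ℝ) else 0 :=
            (hite n t).comp measurable_fst
          exact (((hpm.pow_const m).mul h1).mul h2).aestronglyMeasurable
        · have : ∀ᵐ p ∂(P.prod (volume.restrict (Ioo 0 t))), p.2 ∈ Ioo 0 t :=
            Measure.quasiMeasurePreserving_snd.ae (ae_restrict_mem measurableSet_Ioo)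
          filter_upwards [this] with p hp
          simp only [Function.uncurry, norm_mul, Real.norm_eq_abs]
          have h1 := hpow p.2 (Ioo_subset_Ioc_self hp) p.1
          have h2 := abs_evenInd_le (N p.2.toNNReal p.1)
          have h3 : |if N t.toNNReal p.1 = n then (1 : ℝ) else 0| ≤ 1 := by
            split_ifs <;> simp
          calc _ ≤ t ^ m * 1 * 1 := by gcongr
            _ = t ^ m := by ring
    rw [hswap, setIntegral_congr_fun measurableSet_Ioo key, ← integral_Ioc_eq_integral_Ioo,
      ← intervalIntegral.integral_of_le ht, intervalIntegral.integral_finsetSum]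
    -- The Beta integral yields the same power of t for every k. Only a ratio of factorials depends
    -- on k, and its sum over even k is the hockey-stick sum.
    · have e : ∀ k ∈ Finset.range (n + 1), ∫ r in (0 : ℝ)..t, (if Even k then
            Real.exp (-(a * t)) * a ^ n * ((m + k / 2).factorial / (k / 2).factorial) *
            (r ^ (k + m) / (k + m).factorial * ((t - r) ^ (n - k) / (n - k).factorial)) else 0) =
          Real.exp (-(a * t)) * a ^ n * (t ^ (n + (m + 1)) / (n + (m + 1)).factorial) *
          if Even k then ((m + k / 2).factorial : ℝ) / (k / 2).factorial else 0 := by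
        intro k hk
        have hk' := Nat.lt_succ_iff.1 (Finset.mem_range.1 hk)
        split_ifs
        · rw [intervalIntegral.integral_const_mul, integral_pow_div_factorial_mul,
            show k + m + (n - k) + 1 = n + (m + 1) by omega]
          ring
        · simp
      rw [Finset.sum_congr rfl e, ← Finset.mul_sum,
        sum_range_even (fun j => ((m + j).factorial : ℝ) / j.factorial),
        ← sum_range_factorial_div]
      ring
    · intro k _
      refine Continuous.intervalIntegrable ?_ _ _
      split_ifs <;> fun_prop

end IsPoissonProcess

/-! ### From moments to densities. -/

/-- Finite measures on a compact interval are determined by their moments. -/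
theorem measure_eq_of_moments {μ ν : Measure ℝ} [IsFiniteMeasure μ] [IsFiniteMeasure ν]
    {x y : ℝ} (hμ : ∀ᵐ u ∂μ, u ∈ Icc x y) (hν : ∀ᵐ u ∂ν, u ∈ Icc x y)
    (h : ∀ m : ℕ, ∫ u, u ^ m ∂μ = ∫ u, u ^ m ∂ν) : μ = ν := by
  have hint : ∀ (κ : Measure ℝ) [IsFiniteMeasure κ], (∀ᵐ u ∂κ, u ∈ Icc x y) →
      ∀ f : ℝ → ℝ, Continuous f → Integrable f κ := by
    intro κ _ hκ f hf
    obtain ⟨C, hC⟩ := isCompact_Icc.exists_bound_of_continuousOn (s := Icc x y) hf.continuousOn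
    exact Integrable.of_bound hf.aestronglyMeasurable C (hκ.mono hC)
  have hpoly : ∀ p : Polynomial ℝ, ∫ u, p.eval u ∂μ = ∫ u, p.eval u ∂ν := by
    intro p
    simp_rw [Polynomial.eval_eq_sum_range]
    rw [integral_finsetSum _ fun i _ => hint μ hμ _ (by fun_prop),
      integral_finsetSum _ fun i _ => hint ν hν _ (by fun_prop)]
    refine Finset.sum_congr rfl fun i _ => ?_
    rw [integral_const_mul, integral_const_mul, h]
  refine ext_of_forall_integral_eq_of_IsFiniteMeasure fun f => ?_
  refine eq_of_forall_dist_le fun ε hε => ?_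
  -- An error ε / M in the uniform approximation costs at most ε over both measures together; the
  -- summand 1 keeps M positive.
  let M := μ.real univ + ν.real univ + 1
  have hM : 0 < M := by positivity
  obtain ⟨p, hp⟩ := exists_polynomial_near_of_continuousOn x y f f.continuous.continuousOn
    (ε / M) (by positivity)
  have hdist : ∀ (κ : Measure ℝ) [IsFiniteMeasure κ], (∀ᵐ u ∂κ, u ∈ Icc x y) →
      |∫ u, p.eval u ∂κ - ∫ u, f u ∂κ| ≤ ε / M * κ.real univ := by
    intro κ _ hκ
    rw [← integral_sub (hint κ hκ _ p.continuous) (hint κ hκ _ f.continuous)]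
    exact norm_integral_le_of_norm_le_const (f := fun u => p.eval u - f u) (hκ.mono fun u hu => (hp u hu).le)
  have h1 := abs_le.1 (hdist μ hμ)
  have h2 := abs_le.1 (hdist ν hν)
  rw [hpoly p] at h1
  have h3 : ε / M * μ.real univ + ε / M * ν.real univ ≤ ε := by
    have : ε / M * M = ε := by field_simp
    have h4 : 0 ≤ ε / M := by positivity
    simp only [M] at this h4 ⊢
    nlinarith
  rw [Real.dist_eq, abs_le]
  constructor <;> linarith

/-- The density of the time spent in even states, on the event of exactly `n ≥ 1` jumps. -/
noncomputable def jumpDensity (a t : ℝ) (n : ℕ) (u : ℝ) : ℝ :=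
  Real.exp (-(a * t)) * a ^ n *
    (u ^ (n / 2) / (n / 2).factorial * ((t - u) ^ (n - 1 - n / 2) / (n - 1 - n / 2).factorial))

theorem continuous_jumpDensity (a t : ℝ) (n : ℕ) : Continuous (jumpDensity a t n) := by
  unfold jumpDensity; fun_prop

theorem jumpDensity_nonneg {a t u : ℝ} (ha : 0 < a) (hu : u ∈ Icc 0 t) (n : ℕ) :
    0 ≤ jumpDensity a t n u := by
  have h1 := hu.1
  have h2 := sub_nonneg.2 hu.2
  unfold jumpDensity
  positivity

/-- These are the moments found in `moment`. The factor u ^ m joins the power of u and leaves a Beta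
integral. For n = 0 the truncated exponent n - 1 - n / 2 would be off by one. -/
theorem integral_pow_mul_jumpDensity {a t : ℝ} (ht : 0 ≤ t) (m : ℕ) {n : ℕ} (hn : n ≠ 0) :
    ∫ u in Ioc 0 t, u ^ m * jumpDensity a t n u =
      Real.exp (-(a * t)) * a ^ n * (t ^ (n + m) / (n + m).factorial) *
        ((m + n / 2).factorial / (n / 2).factorial) := by
  rw [← intervalIntegral.integral_of_le ht]
  have e : ∀ u, u ^ m * jumpDensity a t n u = Real.exp (-(a * t)) * a ^ n *
      ((m + n / 2).factorial / (n / 2).factorial) * (u ^ (m + n / 2) / (m + n / 2).factorial *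
      ((t - u) ^ (n - 1 - n / 2) / (n - 1 - n / 2).factorial)) := fun u => by
    unfold jumpDensity
    have h1 : ((m + n / 2).factorial : ℝ) ≠ 0 := by positivity
    rw [pow_add]
    field_simp
  simp_rw [e]
  rw [intervalIntegral.integral_const_mul, integral_pow_div_factorial_mul,
    show m + n / 2 + (n - 1 - n / 2) + 1 = n + m by omega]
  ring

namespace IsPoissonProcess

variable {Ω : Type*} [MeasurableSpace Ω] {a : ℝ} {N : ℝ≥0 → Ω → ℕ} {P : Measure Ω}

theorem primitive_evenInd_mem {Ω : Type*} {N : ℝ≥0 → Ω → ℕ} {t : ℝ} (ht : 0 ≤ t) (ω : Ω) :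
    primitive evenInd N t ω ∈ Icc 0 t := by
  constructor
  · refine intervalIntegral.integral_nonneg ht fun s _ => ?_
    unfold evenInd; split_ifs <;> simp
  · have := abs_primitive_le (N := N) abs_evenInd_le ω ht
    rw [one_mul] at this
    exact (le_abs_self _).trans this

theorem measurableSet_eq (hN : IsPoissonProcess a N P) (t : ℝ≥0) (n : ℕ) :
    MeasurableSet {ω | N t ω = n} :=
  hN.measurable t (measurableSet_singleton n)

theorem integral_pow_map_restrict [IsProbabilityMeasure P] (ha : 0 < a)
    (hN : IsPoissonProcess a N P) (m n : ℕ) {t : ℝ} (ht : 0 ≤ t) :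
    ∫ u, u ^ m ∂((P.restrict {ω | N t.toNNReal ω = n}).map (primitive evenInd N t)) =
      Real.exp (-(a * t)) * a ^ n * (t ^ (n + m) / (n + m).factorial) *
        ((m + n / 2).factorial / (n / 2).factorial) := by
  rw [integral_map (hN.measurable_primitive evenInd ht).aemeasurable
    (by fun_prop), ← hN.moment ha m n ht, ← integral_indicator (hN.measurableSet_eq _ n)]
  refine integral_congr_ae (Eventually.of_forall fun ω => ?_)
  by_cases h : N t.toNNReal ω = n
  · simp only [h, if_true, mul_one]
    exact Set.indicator_of_mem (show ω ∈ {ω | N t.toNNReal ω = n} from h) _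
  · simp only [h, if_false, mul_zero]
    exact Set.indicator_of_notMem (show ω ∉ {ω | N t.toNNReal ω = n} from h) _

theorem ae_map_restrict_mem (hN : IsPoissonProcess a N P) {t : ℝ} (ht : 0 ≤ t) (n : ℕ) :
    ∀ᵐ u ∂((P.restrict {ω | N t.toNNReal ω = n}).map (primitive evenInd N t)), u ∈ Icc 0 t :=
  (ae_map_iff (hN.measurable_primitive evenInd ht).aemeasurable measurableSet_Icc).2
    (Eventually.of_forall fun ω => primitive_evenInd_mem ht ω)

/-- Without jumps, the whole time is spent in the initial state. -/
theorem setIntegral_zero_jumps [IsProbabilityMeasure P] (ha : 0 < a)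
    (hN : IsPoissonProcess a N P) {t : ℝ} (ht : 0 ≤ t) {f : ℝ → ℝ} (hf : Measurable f) :
    ∫ ω in {ω | N t.toNNReal ω = 0}, f (primitive evenInd N t ω) ∂P =
      Real.exp (-(a * t)) * f t := by
  -- For n = 0 the factorials cancel and the moments are exp(-at) t ^ m, those of a weighted point
  -- mass at t.
  have h : (P.restrict {ω | N t.toNNReal ω = 0}).map (primitive evenInd N t) =
      ENNReal.ofReal (Real.exp (-(a * t))) • Measure.dirac t := by
    have : IsFiniteMeasure (ENNReal.ofReal (Real.exp (-(a * t))) • Measure.dirac t) :=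
      Measure.smul_finite _ ENNReal.ofReal_ne_top
    refine measure_eq_of_moments (hN.ae_map_restrict_mem ht 0) ?_ fun m => ?_
    · refine Measure.ae_smul_measure ?_ _
      exact (ae_dirac_iff (p := fun u => u ∈ Icc 0 t) measurableSet_Icc).2 ⟨ht, le_rfl⟩
    · rw [hN.integral_pow_map_restrict ha m 0 ht, integral_smul_measure, integral_dirac,
        ENNReal.toReal_ofReal (Real.exp_nonneg _)]
      have : (m.factorial : ℝ) ≠ 0 := by positivity
      simp
      field_simp
  rw [← integral_map (hN.measurable_primitive evenInd ht).aemeasurable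
    hf.aestronglyMeasurable, h, integral_smul_measure, integral_dirac,
    ENNReal.toReal_ofReal (Real.exp_nonneg _), smul_eq_mul]

/-- With `n ≥ 1` jumps, the time spent in even states has density `jumpDensity`. -/
theorem setIntegral_jumps [IsProbabilityMeasure P] (ha : 0 < a)
    (hN : IsPoissonProcess a N P) {t : ℝ} (ht : 0 ≤ t) {n : ℕ} (hn : n ≠ 0)
    {f : ℝ → ℝ} (hf : Measurable f) :
    ∫ ω in {ω | N t.toNNReal ω = n}, f (primitive evenInd N t ω) ∂P =
      ∫ u in Ioc 0 t, f u * jumpDensity a t n u := by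
  have hsm : ∀ f : ℝ → ℝ, ∫ u, f u ∂((volume.restrict (Ioc 0 t)).withDensity
      fun u => ENNReal.ofReal (jumpDensity a t n u)) =
      ∫ u in Ioc 0 t, f u * jumpDensity a t n u := fun f => by
    rw [integral_withDensity_eq_integral_toReal_smul
      (continuous_jumpDensity a t n).measurable.ennreal_ofReal
      (Eventually.of_forall fun _ => ENNReal.ofReal_lt_top)]
    refine setIntegral_congr_fun measurableSet_Ioc fun u hu => ?_
    simp only [smul_eq_mul]
    rw [ENNReal.toReal_ofReal (jumpDensity_nonneg ha (Ioc_subset_Icc_self hu) n), mul_comm]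
  have h : (P.restrict {ω | N t.toNNReal ω = n}).map (primitive evenInd N t) =
      (volume.restrict (Ioc 0 t)).withDensity fun u => ENNReal.ofReal (jumpDensity a t n u) := by
    have : IsFiniteMeasure ((volume.restrict (Ioc 0 t)).withDensity
        fun u => ENNReal.ofReal (jumpDensity a t n u)) :=
      isFiniteMeasure_withDensity_ofReal
        ((continuous_jumpDensity a t n).integrableOn_Ioc (a := 0) (b := t)).2
    refine measure_eq_of_moments (hN.ae_map_restrict_mem ht n) ?_ fun m => ?_
    · refine (withDensity_absolutelyContinuous _ _).ae_le ?_
      exact (ae_restrict_mem measurableSet_Ioc).mono fun u hu => Ioc_subset_Icc_self hu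
    · rw [hN.integral_pow_map_restrict ha m n ht, hsm, integral_pow_mul_jumpDensity ht m hn]
  rw [← integral_map (hN.measurable_primitive evenInd ht).aemeasurable
    hf.aestronglyMeasurable, h, hsm]

end IsPoissonProcess

/-! ### Bessel series, and sums over the number of jumps. -/

theorem summable_besselI (k : ℕ) (z : ℝ) :
    Summable fun m : ℕ => (z / 2) ^ (2 * m + k) / ((m.factorial : ℝ) * ((m + k).factorial : ℝ)) := by
  refine Summable.of_norm_bounded (g := fun m : ℕ => |z / 2| ^ k * (((z / 2) ^ 2) ^ m / m.factorial))
    ((Real.summable_pow_div_factorial _).mul_left _) fun m => ?_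
  have h1 : (1 : ℝ) ≤ ((m + k).factorial : ℝ) := by exact_mod_cast (m + k).factorial_pos
  have h2 : (0 : ℝ) < (m.factorial : ℝ) := by positivity
  rw [norm_div, norm_pow, Real.norm_eq_abs, Real.norm_of_nonneg (by positivity), pow_add, pow_mul,
    sq_abs, mul_comm, mul_div_assoc]
  gcongr
  nlinarith

theorem hasSum_besselI (k : ℕ) (z : ℝ) :
    HasSum (fun m : ℕ => (z / 2) ^ (2 * m + k) / ((m.factorial : ℝ) * ((m + k).factorial : ℝ)))
      (besselI k z) :=
  (summable_besselI k z).hasSum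

theorem besselI_zero_pos (z : ℝ) : 0 < besselI 0 z := by
  refine (summable_besselI 0 z).tsum_pos (fun m => ?_) 0 (by simp)
  rw [add_zero, pow_mul]
  positivity

theorem besselI_one_pos {z : ℝ} (hz : 0 < z) : 0 < besselI 1 z :=
  (summable_besselI 1 z).tsum_pos (fun m => by positivity) 0 (by simp [hz])

theorem hasDerivAt_besselI_zero (z : ℝ) : HasDerivAt (besselI 0) (besselI 1 z) z := by
  let g : ℕ → ℝ → ℝ := fun m z => (z / 2) ^ (2 * m + 0) / ((m.factorial : ℝ) * (m + 0).factorial)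
  -- At m = 0 the truncated exponent 2m - 1 is harmless, because the factor m vanishes. Dropping
  -- this term and shifting the index gives the series of I₁.
  let g' : ℕ → ℝ → ℝ := fun m z => m * (z / 2) ^ (2 * m - 1) / ((m.factorial : ℝ) * m.factorial)
  have hg' : ∀ m z, g' (m + 1) z =
      (z / 2) ^ (2 * m + 1) / ((m.factorial : ℝ) * (m + 1).factorial) := fun m z => by
    simp only [g']
    rw [show 2 * (m + 1) - 1 = 2 * m + 1 by omega, Nat.factorial_succ]
    have : (m.factorial : ℝ) ≠ 0 := by positivity
    push_cast
    field_simp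
  have hs : ∀ z, HasSum (fun m => g' m z) (besselI 1 z) := fun z => by
    rw [← hasSum_nat_add_iff' 1]
    simpa [hg', g'] using hasSum_besselI 1 z
  have hd : ∀ m z, HasDerivAt (g m) (g' m z) z := fun m z => by
    have h := ((((hasDerivAt_id z).div_const 2).pow (2 * m + 0)).div_const
      ((m.factorial : ℝ) * (m + 0).factorial))
    convert! h using 1
    simp only [g', id, add_zero]
    push_cast
    ring
  -- The differentiated series at |z| + 1 has nonnegative terms and serves as majorant on the ball
  -- of that radius.
  have h := hasDerivAt_tsum_of_isPreconnected (u := fun m => g' m (|z| + 1)) (g := g) (g' := g')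
    (t := Metric.ball 0 (|z| + 1)) (y₀ := 0) (y := z) (hs _).summable Metric.isOpen_ball
    (convex_ball _ _).isPreconnected (fun m y _ => hd m y) (fun m y hy => ?_)
    (by simp; positivity) (summable_besselI 0 0) (by simp)
  · rw [(hs z).tsum_eq] at h
    exact h
  · have hy' : |y| ≤ |z| + 1 := by simpa using (mem_ball_zero_iff.1 hy).le
    simp only [g']
    rw [norm_div, norm_mul, norm_pow, Real.norm_eq_abs (y / 2), abs_div, abs_two,
      Real.norm_of_nonneg (by positivity : (0 : ℝ) ≤ (m.factorial : ℝ) * m.factorial),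
      Real.norm_of_nonneg (by positivity : (0 : ℝ) ≤ (m : ℝ))]
    gcongr

theorem deriv_besselI_zero : deriv (besselI 0) = besselI 1 :=
  funext fun z => (hasDerivAt_besselI_zero z).deriv

theorem measurable_besselI_zero : Measurable (besselI 0) :=
  (continuous_iff_continuousAt.2 fun z => (hasDerivAt_besselI_zero z).continuousAt).measurable

/-- For n = 2k + 1 both exponents equal k, so the terms are (a²u(t - u))^k / k!², the series of I₀
at twice a√(u(t - u)). -/
theorem hasSum_jumpDensity_odd (a : ℝ) {t u : ℝ} (hu : u ∈ Icc 0 t) :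
    HasSum (fun k => jumpDensity a t (2 * k + 1) u)
      (Real.exp (-(a * t)) * a * besselI 0 (2 * (a * Real.sqrt (u * (t - u))))) := by
  have h := (hasSum_besselI 0 (2 * (a * Real.sqrt (u * (t - u))))).mul_left
    (Real.exp (-(a * t)) * a)
  refine h.congr_fun fun k => ?_
  have hs : Real.sqrt (u * (t - u)) ^ 2 = u * (t - u) :=
    Real.sq_sqrt (mul_nonneg hu.1 (sub_nonneg.2 hu.2))
  unfold jumpDensity
  rw [show (2 * k + 1) / 2 = k by omega, show 2 * k + 1 - 1 - k = k by omega,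
    mul_div_cancel_left₀ _ (two_ne_zero' ℝ), add_zero, add_zero, mul_pow, pow_mul (√_), hs,
    mul_pow u]
  ring

/-- For n = 2k + 2 the exponents are k + 1 and k. The surplus factor u against the odd power of the
square root in I₁ produces the quotient, so the endpoints are excluded. -/
theorem hasSum_jumpDensity_even (a : ℝ) {t u : ℝ} (hu : u ∈ Ioo 0 t) :
    HasSum (fun k => jumpDensity a t (2 * k + 2) u)
      (Real.exp (-(a * t)) * a * (u / Real.sqrt (u * (t - u)) *
        besselI 1 (2 * (a * Real.sqrt (u * (t - u)))))) := by
  have h := ((hasSum_besselI 1 (2 * (a * Real.sqrt (u * (t - u))))).mul_left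
    (u / Real.sqrt (u * (t - u)))).mul_left (Real.exp (-(a * t)) * a)
  refine h.congr_fun fun k => ?_
  have hp : 0 < u * (t - u) := mul_pos hu.1 (sub_pos.2 hu.2)
  have hs : Real.sqrt (u * (t - u)) ^ 2 = u * (t - u) := Real.sq_sqrt hp.le
  have hs0 : Real.sqrt (u * (t - u)) ≠ 0 := (Real.sqrt_pos.2 hp).ne'
  unfold jumpDensity
  rw [show (2 * k + 2) / 2 = k + 1 by omega, show 2 * k + 2 - 1 - (k + 1) = k by omega,
    mul_div_cancel_left₀ _ (two_ne_zero' ℝ), mul_pow, pow_succ (√_), pow_mul (√_), hs,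
    mul_pow u]
  field_simp
  ring

/-- The velocity of the unit-speed process solves `W (t I₁ + r I₀) = y I₁`; this is the algebraic
identity behind the conditional expectation. -/
theorem tsum_jumpDensity_reflect {a t u : ℝ} (hu : u ∈ Ioo 0 t) {w F : ℝ}
    (hw : w * (t * besselI 1 (a * Real.sqrt (t ^ 2 - (2 * u - t) ^ 2)) +
      Real.sqrt (t ^ 2 - (2 * u - t) ^ 2) * besselI 0 (a * Real.sqrt (t ^ 2 - (2 * u - t) ^ 2))) =
      (2 * u - t) * besselI 1 (a * Real.sqrt (t ^ 2 - (2 * u - t) ^ 2))) :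
    ∑' n : ℕ, F * ((-1) ^ (n + 1) - w) * jumpDensity a t (n + 1) u +
      ∑' n : ℕ, -F * ((-1) ^ (n + 1) - -w) * jumpDensity a t (n + 1) (t - u) = 0 := by
  have key : ∀ (v F w : ℝ), v ∈ Ioo 0 t →
      ∑' n : ℕ, F * ((-1) ^ (n + 1) - w) * jumpDensity a t (n + 1) v =
      F * (-1 - w) * (Real.exp (-(a * t)) * a * besselI 0 (2 * (a * Real.sqrt (v * (t - v))))) +
      F * (1 - w) * (Real.exp (-(a * t)) * a * (v / Real.sqrt (v * (t - v)) *
        besselI 1 (2 * (a * Real.sqrt (v * (t - v)))))) := by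
    intro v F w hv
    -- The summation index is one less than the number of jumps: even indices carry direction -1 and
    -- I₀, odd ones direction +1 and I₁.
    refine HasSum.tsum_eq (HasSum.even_add_odd ?_ ?_)
    · refine ((hasSum_jumpDensity_odd a (Ioo_subset_Icc_self hv)).mul_left
        (F * (-1 - w))).congr_fun fun k => ?_
      simp [pow_succ, pow_mul]
    · refine ((hasSum_jumpDensity_even a hv).mul_left (F * (1 - w))).congr_fun fun k => ?_
      simp [pow_succ, pow_mul]
  have hp : 0 < u * (t - u) := mul_pos hu.1 (sub_pos.2 hu.2)
  have e : Real.sqrt (t ^ 2 - (2 * u - t) ^ 2) = 2 * Real.sqrt (u * (t - u)) := by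
    rw [show t ^ 2 - (2 * u - t) ^ 2 = 2 ^ 2 * (u * (t - u)) by ring,
      Real.sqrt_mul (by positivity), Real.sqrt_sq zero_le_two]
  rw [e] at hw
  rw [key u F w hu, key (t - u) (-F) (-w) ⟨sub_pos.2 hu.2, by linarith [hu.1]⟩, sub_sub_cancel,
    mul_comm (t - u) u]
  rw [show a * (2 * √(u * (t - u))) = 2 * (a * √(u * (t - u))) by ring] at hw
  have hs0 : 0 < Real.sqrt (u * (t - u)) := Real.sqrt_pos.2 hp
  -- Since u(t - u) is invariant under reflection, both sums contain the same Bessel values, and the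
  -- claim is a multiple of `hw`.
  generalize Real.sqrt (u * (t - u)) = s at *
  generalize besselI 0 (2 * (a * s)) = b0 at *
  generalize besselI 1 (2 * (a * s)) = b1 at *
  generalize Real.exp (-(a * t)) = x at *
  field_simp
  linear_combination (-F * x * a) * hw

/-! ### The mean direction against odd functions of the position. -/

/-- The direction after `n` changes. -/
noncomputable def direction (n : ℕ) : ℝ := (-1) ^ n

theorem abs_direction (n : ℕ) : |direction n| = 1 := by simp [direction]

theorem abs_direction_le (n : ℕ) : |direction n| ≤ 1 := (abs_direction n).le

namespace IsPoissonProcess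

variable {Ω : Type*} [MeasurableSpace Ω] {a : ℝ} {N : ℝ≥0 → Ω → ℕ} {P : Measure Ω}

theorem primitive_direction (hN : IsPoissonProcess a N P) (t : ℝ) (ω : Ω) :
    primitive direction N t ω = 2 * primitive evenInd N t ω - t := by
  have e : ∀ n, direction n = 2 * evenInd n - 1 := fun n => by
    unfold direction evenInd
    split_ifs with h
    · rw [h.neg_one_pow]; norm_num
    · rw [(Nat.not_even_iff_odd.1 h).neg_one_pow]; norm_num
  unfold primitive
  simp_rw [e]
  rw [intervalIntegral.integral_sub ((hN.intervalIntegrable abs_evenInd_le ω _ _).const_mul _)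
    intervalIntegrable_const, intervalIntegral.integral_const_mul]
  simp

/-- For a process started in direction `+1`, the mean of the direction against an odd function of
the position is given by the velocity `W`. -/
theorem integral_odd_mul_direction_sub [IsProbabilityMeasure P] (ha : 0 < a)
    (hN : IsPoissonProcess a N P) {t : ℝ} (ht : 0 < t) {F W : ℝ → ℝ} {C : ℝ}
    (hF : Measurable F) (hW : Measurable W) (hFC : ∀ y, |F y| ≤ C) (hW1 : ∀ y, |W y| ≤ 1)
    (hFodd : ∀ y, F (-y) = -F y) (hWodd : ∀ y ∈ Ioo (-t) t, W (-y) = -W y) (hWt : W t = 1)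
    (hWy : ∀ y ∈ Ioo (-t) t, W y * (t * besselI 1 (a * Real.sqrt (t ^ 2 - y ^ 2)) +
      Real.sqrt (t ^ 2 - y ^ 2) * besselI 0 (a * Real.sqrt (t ^ 2 - y ^ 2))) =
      y * besselI 1 (a * Real.sqrt (t ^ 2 - y ^ 2))) :
    ∫ ω, F (primitive direction N t ω) *
      (direction (N t.toNNReal ω) - W (primitive direction N t ω)) ∂P = 0 := by
  let φ : ℕ → ℝ → ℝ := fun n u => F (2 * u - t) * ((-1) ^ n - W (2 * u - t))
  have hφm : ∀ n, Measurable (φ n) := fun n =>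
    (hF.comp (by fun_prop)).mul ((hW.comp (by fun_prop)).const_sub _)
  have hC : 0 ≤ C := (abs_nonneg _).trans (hFC 0)
  have hφ : ∀ n u, |φ n u| ≤ C * 2 := fun n u => by
    simp only [φ, abs_mul]
    refine mul_le_mul (hFC _) ?_ (abs_nonneg _) hC
    calc _ ≤ |(-1 : ℝ) ^ n| + |W (2 * u - t)| := abs_sub _ _
      _ ≤ 1 + 1 := add_le_add (by simp) (hW1 _)
      _ = 2 := by norm_num
  let Z : Ω → ℝ := fun ω => F (primitive direction N t ω) *
      (direction (N t.toNNReal ω) - W (primitive direction N t ω))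
  have hZφ : ∀ ω, Z ω = φ (N t.toNNReal ω) (primitive evenInd N t ω) := fun ω => by
    simp only [Z, φ, hN.primitive_direction, direction]
  have hZm : Measurable Z :=
    (hF.comp (hN.measurable_primitive _ ht.le)).mul
      ((Measurable.of_discrete.comp (hN.measurable _)).sub
        (hW.comp (hN.measurable_primitive _ ht.le)))
  have hZi : Integrable Z P := Integrable.of_bound hZm.aestronglyMeasurable (C * 2)
    (Eventually.of_forall fun ω => by rw [hZφ]; exact hφ _ _)
  have h1 : HasSum (fun n => ∫ ω in {ω | N t.toNNReal ω = n}, Z ω ∂P) (∫ ω, Z ω ∂P) := by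
    have := hasSum_integral_iUnion (μ := P) (f := Z)
      (s := fun n : ℕ => {ω | N t.toNNReal ω = n}) (fun n => hN.measurableSet_eq _ n)
      (fun m n hmn => Set.disjoint_left.2 fun ω hm hn => hmn (hm.symm.trans hn))
      hZi.integrableOn
    have hU : ⋃ n : ℕ, {ω | N t.toNNReal ω = n} = univ :=
      eq_univ_of_forall fun ω => mem_iUnion.2 ⟨_, rfl⟩
    rwa [hU, setIntegral_univ] at this
  have h2 : ∀ n, ∫ ω in {ω | N t.toNNReal ω = n}, Z ω ∂P =
      ∫ ω in {ω | N t.toNNReal ω = n}, φ n (primitive evenInd N t ω) ∂P := fun n =>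
    setIntegral_congr_fun (hN.measurableSet_eq _ n) fun ω hω => by
      rw [hZφ, show N t.toNNReal ω = n from hω]
  simp_rw [h2] at h1
  rw [← hasSum_nat_add_iff' 1] at h1
  simp only [Finset.sum_range_one, hN.setIntegral_zero_jumps ha ht.le (hφm 0)] at h1
  -- Without jumps the position is t and the direction is +1, which equals W t; the atom contributes
  -- nothing.
  have h3 : φ 0 t = 0 := by simp only [φ, two_mul, add_sub_cancel_right, hWt]; simp
  rw [h3, mul_zero, sub_zero] at h1
  simp_rw [fun n : ℕ => hN.setIntegral_jumps ha ht.le n.succ_ne_zero (hφm (n + 1))] at h1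
  -- Each density has total mass P(N t = n + 1), so the Poisson weights justify exchanging sum and
  -- integral.
  have hbound : ∀ n : ℕ, ∫ u in Ioc 0 t, ‖φ (n + 1) u * jumpDensity a t (n + 1) u‖ ≤
      C * 2 * (Real.exp (-(a * t)) * ((a * t) ^ (n + 1) / (n + 1).factorial)) := by
    intro n
    have e := integral_pow_mul_jumpDensity (a := a) ht.le 0 n.succ_ne_zero
    simp only [pow_zero, one_mul, add_zero, zero_add, Nat.succ_eq_add_one] at e
    rw [div_self (by positivity), mul_one] at e
    calc _ ≤ ∫ u in Ioc 0 t, C * 2 * jumpDensity a t (n + 1) u := by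
          refine setIntegral_mono_on ?_ ?_ measurableSet_Ioc fun u hu => ?_
          · exact (((continuous_jumpDensity a t _).integrableOn_Ioc).bdd_mul
              (hφm _).aestronglyMeasurable (Eventually.of_forall (hφ _))).norm
          · exact ((continuous_jumpDensity a t _).integrableOn_Ioc).const_mul _
          · rw [norm_mul, Real.norm_of_nonneg (jumpDensity_nonneg ha (Ioc_subset_Icc_self hu) _)]
            exact mul_le_mul_of_nonneg_right (hφ _ _)
              (jumpDensity_nonneg ha (Ioc_subset_Icc_self hu) _)
      _ = _ := by
          rw [integral_const_mul, e, mul_pow]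
          ring
  have hsum : Summable fun n : ℕ =>
      ∫ u in Ioc 0 t, ‖φ (n + 1) u * jumpDensity a t (n + 1) u‖ := by
    refine Summable.of_nonneg_of_le (fun n => integral_nonneg fun u => norm_nonneg _) hbound ?_
    exact (((summable_nat_add_iff 1).2 (Real.summable_pow_div_factorial (a * t))).mul_left
      _).mul_left _
  have h4 := integral_tsum_of_summable_integral_norm (μ := volume.restrict (Ioc 0 t))
    (F := fun (n : ℕ) u => φ (n + 1) u * jumpDensity a t (n + 1) u)
    (fun n => ((continuous_jumpDensity a t _).integrableOn_Ioc).bdd_mul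
      (hφm _).aestronglyMeasurable (Eventually.of_forall (hφ _))) hsum
  change ∫ ω, Z ω ∂P = 0
  rw [← h1.tsum_eq, h4,
    ← intervalIntegral.integral_of_le ht.le]
  set H : ℝ → ℝ := fun u => ∑' n : ℕ, φ (n + 1) u * jumpDensity a t (n + 1) u with hH
  -- The summed integrand need not vanish, but it is antisymmetric about t / 2, so its integral
  -- does.
  have h5 : ∀ u ∈ Ioo 0 t, H (t - u) = -H u := by
    intro u hu
    have hy : 2 * u - t ∈ Ioo (-t) t := ⟨by linarith [hu.1], by linarith [hu.2]⟩
    have := tsum_jumpDensity_reflect hu (w := W (2 * u - t)) (F := F (2 * u - t)) (hWy _ hy)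
    rw [eq_neg_iff_add_eq_zero, add_comm, ← this]
    simp only [hH, φ]
    rw [show 2 * (t - u) - t = -(2 * u - t) by ring, hFodd, hWodd _ hy]
  have h6 : ∫ u in (0 : ℝ)..t, H u = -∫ u in (0 : ℝ)..t, H u := by
    have e := intervalIntegral.integral_comp_sub_left (a := 0) (b := t) H t
    rw [sub_self, sub_zero] at e
    conv_lhs => rw [← e]
    rw [intervalIntegral.integral_of_le ht.le, intervalIntegral.integral_of_le ht.le,
      integral_Ioc_eq_integral_Ioo, integral_Ioc_eq_integral_Ioo, ← integral_neg]
    exact setIntegral_congr_fun measurableSet_Ioo h5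
  linarith

end IsPoissonProcess

/-! ### The velocity field in the unit-speed coordinate y = (x - x₀) / c. -/

section Velocity

variable {a c : ℝ} {g : ℝ × ℝ → ℝ} {x₀ t y : ℝ}

theorem measurable_kacVelocity (hg : Measurable g) :
    Measurable fun p : ℝ × ℝ => kacVelocity a c g x₀ p.1 p.2 := by
  unfold kacVelocity radius
  rw [deriv_besselI_zero]
  have h0 := measurable_besselI_zero
  have h1 : Measurable (besselI 1) := deriv_besselI_zero ▸ measurable_deriv _
  refine Measurable.ite ?_ ?_ (Measurable.ite ?_ measurable_const
    (Measurable.ite ?_ measurable_const hg))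
  · have h2 : MeasurableSet {p : ℝ × ℝ | x₀ - c * p.1 < p.2} :=
      measurableSet_lt (by fun_prop) (by fun_prop)
    have h3 : MeasurableSet {p : ℝ × ℝ | p.2 < x₀ + c * p.1} :=
      measurableSet_lt (by fun_prop) (by fun_prop)
    exact h2.inter h3
  · have hr : Measurable fun p : ℝ × ℝ => Real.sqrt (c ^ 2 * p.1 ^ 2 - (p.2 - x₀) ^ 2) := by
      fun_prop
    have hb0 := h0.comp (hr.const_mul (a / c))
    have hb1 := h1.comp (hr.const_mul (a / c))
    exact (measurable_snd.sub_const x₀).mul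
      (measurable_fst.add ((hr.div_const c).mul (hb0.div hb1))).inv
  · exact measurableSet_eq_fun (by fun_prop) (by fun_prop)
  · exact measurableSet_eq_fun (by fun_prop) (by fun_prop)

theorem kacVelocity_inner (hc : 0 < c) (hy : y ∈ Ioo (-t) t) :
    kacVelocity a c g x₀ t (x₀ + c * y) = c * (y * (t + Real.sqrt (t ^ 2 - y ^ 2) *
      (besselI 0 (a * Real.sqrt (t ^ 2 - y ^ 2)) /
        besselI 1 (a * Real.sqrt (t ^ 2 - y ^ 2))))⁻¹) := by
  have hr : radius c t (c * y) = c * Real.sqrt (t ^ 2 - y ^ 2) := by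
    rw [radius, show c ^ 2 * t ^ 2 - (c * y) ^ 2 = c ^ 2 * (t ^ 2 - y ^ 2) by ring,
      Real.sqrt_mul (sq_nonneg c), Real.sqrt_sq hc.le]
  have hmem : x₀ + c * y ∈ Ioo (x₀ - c * t) (x₀ + c * t) :=
    ⟨by nlinarith [hy.1], by nlinarith [hy.2]⟩
  rw [kacVelocity, if_pos hmem, add_sub_cancel_left, hr, deriv_besselI_zero,
    mul_div_cancel_left₀ _ hc.ne', show a / c * (c * √(t ^ 2 - y ^ 2)) = a * √(t ^ 2 - y ^ 2) by
      field_simp]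
  ring

theorem kacVelocity_right : kacVelocity a c g x₀ t (x₀ + c * t) = c := by
  simp [kacVelocity]

/-- At t = 0 the two endpoints coincide and the earlier branch would give c. -/
theorem kacVelocity_left (hc : 0 < c) (ht : 0 < t) :
    kacVelocity a c g x₀ t (x₀ + c * -t) = -c := by
  have h : 0 < c * t := mul_pos hc ht
  rw [mul_neg, ← sub_eq_add_neg, kacVelocity, if_neg (by simp), if_neg (by linarith), if_pos rfl]

theorem kacVelocity_odd (hc : 0 < c) (ht : 0 < t) (hy : y ∈ Icc (-t) t) :
    kacVelocity a c g x₀ t (x₀ + c * -y) = -kacVelocity a c g x₀ t (x₀ + c * y) := by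
  rcases hy.1.eq_or_lt with rfl | h1
  · rw [neg_neg, kacVelocity_right, kacVelocity_left hc ht, neg_neg]
  rcases hy.2.eq_or_lt with rfl | h2
  · rw [kacVelocity_right, kacVelocity_left hc ht]
  · rw [kacVelocity_inner hc ⟨h1, h2⟩, kacVelocity_inner hc ⟨by linarith, by linarith⟩, neg_sq]
    ring

theorem sqrt_sq_sub_sq_pos (hy : y ∈ Ioo (-t) t) : 0 < Real.sqrt (t ^ 2 - y ^ 2) :=
  Real.sqrt_pos.2 (by nlinarith [hy.1, hy.2])

/-- Inside the interval I₁ is positive, so the quotient can be cleared; this is the form required by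
`tsum_jumpDensity_reflect`. -/
theorem kacVelocity_mul (ha : 0 < a) (hc : 0 < c) (hy : y ∈ Ioo (-t) t) :
    kacVelocity a c g x₀ t (x₀ + c * y) / c * (t * besselI 1 (a * Real.sqrt (t ^ 2 - y ^ 2)) +
      Real.sqrt (t ^ 2 - y ^ 2) * besselI 0 (a * Real.sqrt (t ^ 2 - y ^ 2))) =
      y * besselI 1 (a * Real.sqrt (t ^ 2 - y ^ 2)) := by
  have ht : 0 < t := by linarith [hy.1, hy.2]
  have hr := sqrt_sq_sub_sq_pos hy
  rw [kacVelocity_inner hc hy, mul_div_cancel_left₀ _ hc.ne']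
  have h0 := besselI_zero_pos (a * Real.sqrt (t ^ 2 - y ^ 2))
  have h1 := besselI_one_pos (mul_pos ha hr)
  have h2 : 0 < t * besselI 1 (a * √(t ^ 2 - y ^ 2)) +
      √(t ^ 2 - y ^ 2) * besselI 0 (a * √(t ^ 2 - y ^ 2)) := by positivity
  have h3 : t + √(t ^ 2 - y ^ 2) * (besselI 0 (a * √(t ^ 2 - y ^ 2)) /
      besselI 1 (a * √(t ^ 2 - y ^ 2))) = (t * besselI 1 (a * √(t ^ 2 - y ^ 2)) +
      √(t ^ 2 - y ^ 2) * besselI 0 (a * √(t ^ 2 - y ^ 2))) /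
      besselI 1 (a * √(t ^ 2 - y ^ 2)) := by
    rw [eq_div_iff h1.ne', add_mul, mul_assoc, div_mul_cancel₀ _ h1.ne']
  rw [h3, inv_div]
  field_simp

/-- The Bessel quotient only enlarges the denominator, which is thus at least t ≥ |y|. -/
theorem abs_kacVelocity_le (ha : 0 < a) (hc : 0 < c) (ht : 0 < t) (hy : y ∈ Icc (-t) t) :
    |kacVelocity a c g x₀ t (x₀ + c * y)| ≤ c := by
  rcases hy.1.eq_or_lt with rfl | h1
  · rw [kacVelocity_left hc ht, abs_neg, abs_of_pos hc]
  rcases hy.2.eq_or_lt with rfl | h2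
  · rw [kacVelocity_right, abs_of_pos hc]
  · have hr := sqrt_sq_sub_sq_pos (y := y) ⟨h1, h2⟩
    rw [kacVelocity_inner hc ⟨h1, h2⟩, abs_mul, abs_of_pos hc, ← div_eq_mul_inv, abs_div]
    have h0 := besselI_zero_pos (a * Real.sqrt (t ^ 2 - y ^ 2))
    have h1' := besselI_one_pos (mul_pos ha hr)
    have h3 : 0 ≤ √(t ^ 2 - y ^ 2) * (besselI 0 (a * √(t ^ 2 - y ^ 2)) /
      besselI 1 (a * √(t ^ 2 - y ^ 2))) := by positivity
    refine mul_le_of_le_one_right hc.le (div_le_one_of_le₀ ?_ (abs_nonneg _))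
    exact ((abs_le.2 hy).trans (le_add_of_nonneg_right h3)).trans (le_abs_self _)

end Velocity

/-! ### Averaging over the random sign. -/

section Kac

variable {Ω : Type*} [MeasurableSpace Ω] {a c : ℝ} {N : ℝ≥0 → Ω → ℕ} {B : Ω → ℝ} {P : Measure Ω}

theorem ae_sign (hBm : Measurable B)
    (hB : P.map B = (2⁻¹ : ℝ≥0∞) • Measure.dirac (1 : ℝ) + (2⁻¹ : ℝ≥0∞) • Measure.dirac (-1 : ℝ)) :
    ∀ᵐ ω ∂P, B ω = 1 ∨ B ω = -1 := by
  have hs : MeasurableSet {x : ℝ | x = 1 ∨ x = -1} :=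
    (measurableSet_singleton (1 : ℝ)).union (measurableSet_singleton (-1))
  refine (ae_map_iff (p := fun x : ℝ => x = 1 ∨ x = -1) hBm.aemeasurable hs).1 ?_
  rw [hB, ae_add_measure_iff]
  constructor
  · refine Measure.ae_smul_measure ?_ _
    exact (ae_dirac_iff hs).2 (Or.inl rfl)
  · refine Measure.ae_smul_measure ?_ _
    exact (ae_dirac_iff hs).2 (Or.inr rfl)

/-- Averaging over an independent symmetric sign. -/
theorem integral_sign_prod [IsProbabilityMeasure P] (hBm : Measurable B)
    (hB : P.map B = (2⁻¹ : ℝ≥0∞) • Measure.dirac (1 : ℝ) + (2⁻¹ : ℝ≥0∞) • Measure.dirac (-1 : ℝ))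
    {E : Type*} [MeasurableSpace E] {Y : Ω → E} (hY : Measurable Y) (hBY : IndepFun B Y P)
    {G : ℝ → E → ℝ} (hG : Measurable fun p : ℝ × E => G p.1 p.2)
    (hi : Integrable (fun ω => G (B ω) (Y ω)) P) :
    ∫ ω, G (B ω) (Y ω) ∂P = 2⁻¹ * ∫ ω, G 1 (Y ω) ∂P + 2⁻¹ * ∫ ω, G (-1) (Y ω) ∂P := by
  have hprod := (indepFun_iff_map_prod_eq_prod_map_map hBm.aemeasurable hY.aemeasurable).1 hBY
  have : IsProbabilityMeasure (P.map B) := Measure.isProbabilityMeasure_map hBm.aemeasurable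
  have : IsProbabilityMeasure (P.map Y) := Measure.isProbabilityMeasure_map hY.aemeasurable
  have hi' : Integrable (fun p : ℝ × E => G p.1 p.2) ((P.map B).prod (P.map Y)) := by
    rw [← hprod]
    exact (integrable_map_measure hG.aestronglyMeasurable
      (hBm.prodMk hY).aemeasurable).2 hi
  have e1 : ∫ ω, G (B ω) (Y ω) ∂P = ∫ p, G p.1 p.2 ∂(P.map fun ω => (B ω, Y ω)) := by
    rw [integral_map (hBm.prodMk hY).aemeasurable hG.aestronglyMeasurable]
  have e2 : ∀ b, ∫ y, G b y ∂(P.map Y) = ∫ ω, G b (Y ω) ∂P := fun b => by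
    rw [integral_map hY.aemeasurable]
    exact (hG.comp (measurable_const.prodMk measurable_id)).aestronglyMeasurable
  have h3 := hi'.integral_prod_left
  rw [e1, hprod, integral_prod _ hi']
  simp_rw [e2] at h3 ⊢
  have hfin : ∀ x : ℝ, Integrable (fun b => ∫ ω, G b (Y ω) ∂P) (Measure.dirac x) := fun x =>
    integrable_dirac (by simp)
  rw [hB, integral_add_measure ((hfin 1).smul_measure (by simp))
    ((hfin (-1)).smul_measure (by simp)), integral_smul_measure, integral_smul_measure,
    integral_dirac, integral_dirac]
  simp

/-- The velocity field is the conditional mean of the direction of motion given the position. -/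
theorem integral_mul_velocity_sub [IsProbabilityMeasure P] (ha : 0 < a) (hc : 0 < c)
    (hBm : Measurable B)
    (hB : P.map B = (2⁻¹ : ℝ≥0∞) • Measure.dirac (1 : ℝ) + (2⁻¹ : ℝ≥0∞) • Measure.dirac (-1 : ℝ))
    (hN : IsPoissonProcess a N P) (hBN : IndepFun B (fun ω (t : ℝ≥0) => N t ω) P)
    {g : ℝ × ℝ → ℝ} (hg : Measurable g) (x₀ : ℝ) {t : ℝ} (ht : 0 < t) {f : ℝ → ℝ}
    (hf : Measurable f) {C : ℝ} (hfC : ∀ x, |f x| ≤ C) :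
    ∫ ω, f (B ω * (c * primitive direction N t ω)) * (B ω * (c * direction (N t.toNNReal ω)) -
      kacVelocity a c g x₀ t (x₀ + B ω * (c * primitive direction N t ω))) ∂P = 0 := by
  let Y : Ω → ℝ × ℕ := fun ω => (primitive direction N t ω, N t.toNNReal ω)
  let v : ℝ → ℝ := fun y => kacVelocity a c g x₀ t (x₀ + c * y)
  have hvm : Measurable v := by
    have h : Measurable fun y : ℝ => (t, x₀ + c * y) := by fun_prop
    exact (measurable_kacVelocity hg).comp h
  -- The cutoff removes the arbitrary values of g, which the process never sees, and leaves a
  -- function bounded by 1.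
  let W : ℝ → ℝ := (Icc (-t) t).indicator fun y => v y / c
  have hWm : Measurable W := (hvm.div_const c).indicator measurableSet_Icc
  have hWin : ∀ y ∈ Icc (-t) t, v y = c * W y := fun y hy => by
    simp only [W, indicator_of_mem hy]
    field_simp
  have hτ : ∀ ω, primitive direction N t ω ∈ Icc (-t) t := fun ω => by
    have := IsPoissonProcess.abs_primitive_le (N := N) abs_direction_le ω ht.le
    rw [one_mul] at this
    exact abs_le.1 this
  -- Because the velocity is odd, its value at the reflected position is the sign times its value at
  -- τ.
  let G : ℝ → ℝ × ℕ → ℝ := fun b y =>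
    f (b * (c * y.1)) * (b * (c * direction y.2) - b * (c * W y.1))
  have hGm : Measurable fun p : ℝ × (ℝ × ℕ) => G p.1 p.2 := by
    have h1 : Measurable fun p : ℝ × (ℝ × ℕ) => direction p.2.2 :=
      (Measurable.of_discrete (f := direction)).comp (measurable_snd.comp measurable_snd)
    have h2 : Measurable fun p : ℝ × (ℝ × ℕ) => W p.2.1 :=
      hWm.comp (measurable_fst.comp measurable_snd)
    have h3 : Measurable fun p : ℝ × (ℝ × ℕ) => f (p.1 * (c * p.2.1)) :=
      hf.comp (by fun_prop)
    exact h3.mul ((measurable_fst.mul (h1.const_mul c)).sub (measurable_fst.mul (h2.const_mul c)))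
  have hYm : Measurable Y := (hN.measurable_primitive _ ht.le).prodMk (hN.measurable _)
  have hBY : IndepFun B Y P := by
    refine indep_of_indep_of_le_right hBN (Measurable.comap_le ?_)
    have hpast : past N t.toNNReal ≤ MeasurableSpace.comap (fun ω (t : ℝ≥0) => N t ω)
        inferInstance := by
      refine iSup_le fun r => Measurable.comap_le ?_
      have h : Measurable fun x : ℝ≥0 → ℕ => x r.1 := measurable_pi_apply r.1
      exact h.comp (comap_measurable _)
    exact ((hN.measurable_primitive_past direction ht.le).mono hpast le_rfl).prodMk
      ((measurable_past le_rfl).mono hpast le_rfl)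
  have hW1 : ∀ y, |W y| ≤ 1 := fun y => by
    by_cases hy : y ∈ Icc (-t) t
    · simp only [W, indicator_of_mem hy, abs_div, abs_of_pos hc]
      exact div_le_one_of_le₀ (abs_kacVelocity_le ha hc ht hy) hc.le
    · simp [W, indicator_of_notMem hy]
  have hC : 0 ≤ C := (abs_nonneg _).trans (hfC 0)
  have e1 : ∀ᵐ ω ∂P, f (B ω * (c * primitive direction N t ω)) *
      (B ω * (c * direction (N t.toNNReal ω)) -
      kacVelocity a c g x₀ t (x₀ + B ω * (c * primitive direction N t ω))) = G (B ω) (Y ω) := by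
    filter_upwards [ae_sign hBm hB] with ω hω
    simp only [G, Y]
    rw [← hWin _ (hτ ω)]
    rcases hω with h | h <;> rw [h]
    · simp only [one_mul, v]
    · congr 2
      rw [neg_one_mul (v _), ← kacVelocity_odd hc ht (hτ ω)]
      congr 2
      ring
  have hGi : Integrable (fun ω => G (B ω) (Y ω)) P := by
    refine Integrable.of_bound (hGm.comp (hBm.prodMk hYm)).aestronglyMeasurable (C * (c * 2)) ?_
    filter_upwards [ae_sign hBm hB] with ω hω
    have hb : |B ω| = 1 := by rcases hω with h | h <;> simp [h]
    simp only [G, ← mul_sub, norm_mul, Real.norm_eq_abs, hb, one_mul, abs_of_pos hc]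
    refine mul_le_mul (hfC _) (mul_le_mul_of_nonneg_left ?_ hc.le) (by positivity) hC
    calc _ ≤ |direction (Y ω).2| + |W (Y ω).1| := abs_sub _ _
      _ ≤ 1 + 1 := add_le_add (abs_direction_le _) (hW1 _)
      _ = 2 := by norm_num
  rw [integral_congr_ae e1, integral_sign_prod hBm hB hYm hBY hGm hGi, ← mul_add]
  have hG1 : ∀ b : ℝ, |b| = 1 → Integrable (fun ω => G b (Y ω)) P := fun b hb => by
    refine Integrable.of_bound
      (hGm.comp (measurable_const.prodMk hYm)).aestronglyMeasurable (C * (c * 2))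
      (Eventually.of_forall fun ω => ?_)
    simp only [G, ← mul_sub, norm_mul, Real.norm_eq_abs, hb, one_mul, abs_of_pos hc]
    refine mul_le_mul (hfC _) (mul_le_mul_of_nonneg_left ?_ hc.le) (by positivity) hC
    calc _ ≤ |direction (Y ω).2| + |W (Y ω).1| := abs_sub _ _
      _ ≤ 1 + 1 := add_le_add (abs_direction_le _) (hW1 _)
      _ = 2 := by norm_num
  rw [← integral_add (hG1 1 (by simp)) (hG1 (-1) (by simp))]
  -- Adding the terms for the signs 1 and -1 leaves f antisymmetrised, so only odd functions of τ
  -- have to be tested.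
  have h := hN.integral_odd_mul_direction_sub ha ht
    (F := fun y => c * (f (c * y) - f (-(c * y)))) (W := W) (C := c * (C + C))
    ((((hf.comp (by fun_prop)).sub (hf.comp (by fun_prop))).const_mul c)) hWm
    (fun y => by
      rw [abs_mul, abs_of_pos hc]
      exact mul_le_mul_of_nonneg_left ((abs_sub _ _).trans (add_le_add (hfC _) (hfC _))) hc.le)
    hW1 (fun y => by simp only [mul_neg, neg_neg]; ring)
    (fun y hy => by
      have h1 := hWin y (Ioo_subset_Icc_self hy)
      have h2 := hWin (-y) ⟨by linarith [hy.2], by linarith [hy.1]⟩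
      have h3 : v (-y) = - v y := kacVelocity_odd hc ht (Ioo_subset_Icc_self hy)
      rw [h1, h2] at h3
      exact mul_left_cancel₀ hc.ne' (by linarith))
    (by
      have h1 := hWin t ⟨by linarith, le_rfl⟩
      have h2 : v t = c := kacVelocity_right
      rw [h2] at h1
      exact mul_left_cancel₀ hc.ne' (by linarith))
    (fun y hy => by
      have := kacVelocity_mul (g := g) (x₀ := x₀) ha hc hy
      simpa only [W, indicator_of_mem (Ioo_subset_Icc_self hy)] using this)
  rw [mul_eq_zero]
  right
  rw [← h]
  refine integral_congr_ae (Eventually.of_forall fun ω => ?_)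
  simp only [G, Y, one_mul, neg_mul]
  ring

end Kac

/-! ### Differentiability of the paths at a fixed time. -/

namespace IsPoissonProcess

variable {Ω : Type*} [MeasurableSpace Ω] {a : ℝ} {N : ℝ≥0 → Ω → ℕ} {P : Measure Ω}

/-- Almost surely, a Poisson process does not jump at a fixed time. -/
theorem ae_exists_lt_eq [IsProbabilityMeasure P] (ha : 0 < a) (hN : IsPoissonProcess a N P)
    {t : ℝ} (ht : 0 < t) :
    ∀ᵐ ω ∂P, ∃ s, s < t ∧ N s.toNNReal ω = N t.toNNReal ω := by
  -- These times increase to t from s 0 = 0, and the probability of no jump between s k and t tends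
  -- to 1.
  let s : ℕ → ℝ := fun k => t - t * (1 / ((k : ℝ) + 1))
  have hs0 : ∀ k, 0 ≤ s k := fun k => by
    have : (1 : ℝ) / ((k : ℝ) + 1) ≤ 1 := by
      rw [div_le_one (by positivity)]
      have : (0 : ℝ) ≤ k := k.cast_nonneg
      linarith
    have := mul_le_mul_of_nonneg_left this ht.le
    simp only [s]; linarith
  have hst : ∀ k, s k < t := fun k => by
    have : 0 < t * (1 / ((k : ℝ) + 1)) := by positivity
    simp only [s]; linarith
  let A : ℕ → Set Ω := fun k => {ω | N t.toNNReal ω - N (s k).toNNReal ω = 0}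
  have hA : ∀ k, MeasurableSet (A k) := fun k =>
    ((hN.measurable _).sub (hN.measurable _)) (measurableSet_singleton 0)
  have hPA : ∀ k, P.real (A k) = Real.exp (-(a * (t * (1 / ((k : ℝ) + 1))))) := fun k => by
    have h := hN.integral_increment ha (hs0 k) (hst k) 0
    have e : (fun ω => if N t.toNNReal ω - N (s k).toNNReal ω = 0 then (1 : ℝ) else 0) =
        (A k).indicator 1 := by
      funext ω
      by_cases hω : N t.toNNReal ω - N (s k).toNNReal ω = 0
      · rw [if_pos hω, Set.indicator_of_mem (show ω ∈ A k from hω), Pi.one_apply]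
      · rw [if_neg hω, Set.indicator_of_notMem (show ω ∉ A k from hω)]
    rw [e, integral_indicator_one (hA k)] at h
    rw [h]
    simp [s]
  have hlim : Tendsto (fun k : ℕ => Real.exp (-(a * (t * (1 / ((k : ℝ) + 1)))))) atTop (𝓝 1) := by
    have h1 := ((tendsto_one_div_add_atTop_nhds_zero_nat (𝕜 := ℝ)).const_mul t).const_mul a
    have h2 := (Real.continuous_exp.tendsto _).comp h1.neg
    simpa [Function.comp_def] using h2
  have h1 : 1 ≤ P.real (⋃ k, A k) := le_of_tendsto hlim (Eventually.of_forall fun k => by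
    rw [← hPA k]
    exact measureReal_mono (subset_iUnion A k))
  have h2 : P (⋃ k, A k) = 1 := by
    refine le_antisymm prob_le_one ?_
    rw [← ENNReal.ofReal_one, ← ofReal_measureReal (μ := P)]
    exact ENNReal.ofReal_le_ofReal h1
  have h3 : ∀ᵐ ω ∂P, ω ∈ ⋃ k, A k :=
    (prob_compl_eq_zero_iff (MeasurableSet.iUnion hA)).2 h2
  filter_upwards [h3] with ω hω
  obtain ⟨k, hk⟩ := mem_iUnion.1 hω
  have hk : N t.toNNReal ω - N (s k).toNNReal ω = 0 := hk
  have hle := hN.mono ω (Real.toNNReal_le_toNNReal (hst k).le)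
  exact ⟨s k, hst k, le_antisymm hle (by simpa using Nat.sub_eq_zero_iff_le.1 hk)⟩

/-- Almost surely the path is constant just before t; with right-continuity the integrand is
continuous at t. -/
theorem ae_hasDerivAt_primitive [IsProbabilityMeasure P] (ha : 0 < a)
    (hN : IsPoissonProcess a N P) {h : ℕ → ℝ} {C : ℝ} (hC : ∀ n, |h n| ≤ C)
    {t : ℝ} (ht : 0 < t) :
    ∀ᵐ ω ∂P, HasDerivAt (fun t => primitive h N t ω) (h (N t.toNNReal ω)) t := by
  filter_upwards [hN.ae_exists_lt_eq ha ht] with ω hω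
  obtain ⟨s, hst, hs⟩ := hω
  refine intervalIntegral.integral_hasDerivAt_right (hN.intervalIntegrable hC ω _ _)
    ((Measurable.of_discrete.comp
      (hN.measurable_path ω)).stronglyMeasurable.stronglyMeasurableAtFilter) ?_
  refine continuousAt_iff_continuous_left_right.2 ⟨?_, hN.continuousWithinAt h ω t⟩
  refine (continuousWithinAt_const (b := h (N t.toNNReal ω))).congr_of_eventuallyEq ?_ rfl
  filter_upwards [Icc_mem_nhdsLE hst] with r hr
  have h1 := hN.mono ω (Real.toNNReal_le_toNNReal hr.1)
  have h2 := hN.mono ω (Real.toNNReal_le_toNNReal hr.2)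
  simp only at h1 h2
  rw [le_antisymm h2 (hs ▸ h1)]

end IsPoissonProcess

/-- By Fubini, the independent variable V may be frozen. It will hold the other coordinates of the
position. -/
theorem integral_eq_zero_of_indepFun {Ω E F : Type*} [MeasurableSpace Ω] [MeasurableSpace E]
    [MeasurableSpace F] {P : Measure Ω} [IsProbabilityMeasure P] {Z : Ω → E} {V : Ω → F}
    (hZ : Measurable Z) (hV : Measurable V) (hZV : IndepFun Z V P) {Φ : E → F → ℝ}
    (hΦ : Measurable fun p : E × F => Φ p.1 p.2) (hi : Integrable (fun ω => Φ (Z ω) (V ω)) P)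
    (h0 : ∀ v, ∫ ω, Φ (Z ω) v ∂P = 0) : ∫ ω, Φ (Z ω) (V ω) ∂P = 0 := by
  have hprod := (indepFun_iff_map_prod_eq_prod_map_map hZ.aemeasurable hV.aemeasurable).1 hZV
  have : IsProbabilityMeasure (P.map Z) := Measure.isProbabilityMeasure_map hZ.aemeasurable
  have : IsProbabilityMeasure (P.map V) := Measure.isProbabilityMeasure_map hV.aemeasurable
  have hi' : Integrable (fun p : E × F => Φ p.1 p.2) ((P.map Z).prod (P.map V)) := by
    rw [← hprod]
    exact (integrable_map_measure hΦ.aestronglyMeasurable (hZ.prodMk hV).aemeasurable).2 hi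
  have e1 : ∫ ω, Φ (Z ω) (V ω) ∂P = ∫ p, Φ p.1 p.2 ∂(P.map fun ω => (Z ω, V ω)) := by
    rw [integral_map (hZ.prodMk hV).aemeasurable hΦ.aestronglyMeasurable]
  have e2 : ∀ v, ∫ z, Φ z v ∂(P.map Z) = 0 := fun v => by
    rw [integral_map hZ.aemeasurable, h0 v]
    exact (hΦ.comp (measurable_id.prodMk measurable_const)).aestronglyMeasurable
  rw [e1, hprod, integral_prod_symm _ hi']
  simp [e2]

theorem euclidean_norm_le {d : ℕ} {C : ℝ} {x : EuclideanSpace ℝ (Fin d)}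
    (h : ∀ i, |x i| ≤ C) : ‖x‖ ≤ Real.sqrt (d * C ^ 2) := by
  rw [EuclideanSpace.norm_eq]
  refine Real.sqrt_le_sqrt ?_
  calc ∑ i, ‖x i‖ ^ 2 ≤ ∑ _i : Fin d, C ^ 2 :=
        Finset.sum_le_sum fun i _ => pow_le_pow_left₀ (norm_nonneg _) (h i) 2
    _ = d * C ^ 2 := by simp

/-! ### Test functions along paths. -/

section TestFunction

variable {d : ℕ} {φ : ℝ × EuclideanSpace ℝ (Fin d) → ℝ}

/-- The integrand of the weak equation is the total derivative in direction (1, w), as in the chain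
rule along a path of velocity w. -/
theorem deriv_add_inner_gradient (hφ : Differentiable ℝ φ) (t : ℝ)
    (x w : EuclideanSpace ℝ (Fin d)) :
    deriv (fun s => φ (s, x)) t + inner ℝ (gradient (fun y => φ (t, y)) x) w =
      fderiv ℝ φ (t, x) (1, w) := by
  have h1 : HasDerivAt (fun s => φ (s, x)) (fderiv ℝ φ (t, x) (1, 0)) t :=
    (hφ (t, x)).hasFDerivAt.comp_hasDerivAt t ((hasDerivAt_id t).prodMk (hasDerivAt_const t x))
  have h2 : HasFDerivAt (fun y => φ (t, y))
      ((fderiv ℝ φ (t, x)).comp (ContinuousLinearMap.inr ℝ ℝ _)) x :=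
    (hφ (t, x)).hasFDerivAt.comp x (hasFDerivAt_prodMk_right t x)
  rw [h1.deriv, gradient, InnerProductSpace.toDual_symm_apply, h2.fderiv,
    ContinuousLinearMap.comp_apply, ← map_add]
  simp

/-- The integral of the derivative of a test function along a path vanishes. -/
theorem integral_test_along_path (hφ : ContDiff ℝ ((⊤ : ℕ∞) : WithTop ℕ∞) φ)
    {T : ℝ} (hT : 0 ≤ T) (h0 : ∀ x, φ (0, x) = 0) (hφT : ∀ x, φ (T, x) = 0)
    {γ γ' : ℝ → EuclideanSpace ℝ (Fin d)} (hγ : Continuous γ)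
    (hγ' : ∀ t, HasDerivWithinAt γ (γ' t) (Ici t) t)
    (hint : IntervalIntegrable (fun t => fderiv ℝ φ (t, γ t) (1, γ' t)) volume 0 T) :
    ∫ t in Ioc 0 T, fderiv ℝ φ (t, γ t) (1, γ' t) = 0 := by
  have hd : Differentiable ℝ φ := hφ.differentiable (by simp)
  have h := intervalIntegral.integral_eq_sub_of_hasDeriv_right_of_le hT
    (f := fun t => φ (t, γ t)) (f' := fun t => fderiv ℝ φ (t, γ t) (1, γ' t))
    (hφ.continuous.comp (by fun_prop)).continuousOn
    (fun t _ => (hd (t, γ t)).hasFDerivAt.comp_hasDerivWithinAt t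
      ((hasDerivWithinAt_id t _).prodMk ((hγ' t).mono Ioi_subset_Ici_self))) hint
  rw [← intervalIntegral.integral_of_le hT, h, h0, hφT, sub_zero]

/-- The time support of a test function is contained in a bounded interval. -/
theorem exists_time_bound (hφ : HasCompactSupport φ) :
    ∃ T : ℝ, 0 ≤ T ∧ ∀ t x, T ≤ t → (t, x) ∉ tsupport φ := by
  obtain ⟨R, hR⟩ := (hφ.isCompact.isBounded).exists_norm_le
  refine ⟨|R| + 1, by positivity, fun t x ht hmem => ?_⟩
  have h1 := (norm_fst_le (t, x)).trans (hR _ hmem)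
  have h2 := le_abs_self R
  have h3 := le_abs_self t
  simp only [Real.norm_eq_abs] at h1
  linarith

end TestFunction

/-- The derivative is a limit of right difference quotients. With the σ-algebra generated by a path,
this makes the direction a function of the path. -/
theorem measurable_of_hasDerivWithinAt {Ω : Type*} {m : MeasurableSpace Ω} {f : ℝ → Ω → ℝ}
    {f' : Ω → ℝ} {t : ℝ} (hf : ∀ s, t ≤ s → Measurable (f s))
    (hd : ∀ ω, HasDerivWithinAt (fun s => f s ω) (f' ω) (Ici t) t) : Measurable f' := by
  let q : ℕ → ℝ := fun n => t + 1 / ((n : ℝ) + 1)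
  have hq : ∀ n, t < q n := fun n => by
    have : 0 < 1 / ((n : ℝ) + 1) := by positivity
    simp only [q]; linarith
  have hqt : Tendsto q atTop (𝓝[>] t) := by
    refine tendsto_nhdsWithin_iff.2 ⟨?_, Eventually.of_forall hq⟩
    have := (tendsto_one_div_add_atTop_nhds_zero_nat (𝕜 := ℝ)).const_add t
    simpa [q] using this
  refine measurable_of_tendsto_metrizable
    (f := fun n ω => slope (fun s => f s ω) t (q n)) (fun n => ?_) ?_
  · simp only [slope_def_module, smul_eq_mul]
    exact ((hf _ (hq n).le).sub (hf _ le_rfl)).const_mul _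
  · rw [tendsto_pi_nhds]
    intro ω
    have h1 := (hd ω).mono Ioi_subset_Ici_self
    rw [hasDerivWithinAt_iff_tendsto_slope' (by simp)] at h1
    exact h1.comp hqt

/-! ### The d-dimensional process. -/

variable {Ω : Type*} [MeasurableSpace Ω] {d : ℕ} {a c : ℝ} {B : Fin d → Ω → ℝ}
  {N : Fin d → ℝ≥0 → Ω → ℕ} {P : Measure Ω}

/-- The signs and Poisson processes driving a `d`-dimensional Kac process. -/
structure IsKacDriver (a c : ℝ) (B : Fin d → Ω → ℝ) (N : Fin d → ℝ≥0 → Ω → ℕ)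
    (P : Measure Ω) : Prop where
  measurable_sign : ∀ i, Measurable (B i)
  law_sign : ∀ i, P.map (B i) =
    (2⁻¹ : ℝ≥0∞) • Measure.dirac (1 : ℝ) + (2⁻¹ : ℝ≥0∞) • Measure.dirac (-1 : ℝ)
  poisson : ∀ i, IsPoissonProcess a (N i) P
  indep_sign : ∀ i, IndepFun (B i) (fun ω (t : ℝ≥0) => N i t ω) P
  indep_components : iIndepFun
    (fun i ω (t : ℝ≥0) => B i ω * (c * primitive direction (N i) t ω)) P

/-- Independence across components is assumed for the paths, not for the pairs of sign and Poisson
process, and is kept in that form. -/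
theorem IsMultiKacProcess.exists_driver {K : ℝ → Ω → EuclideanSpace ℝ (Fin d)}
    (hK : IsMultiKacProcess a c K P) :
    ∃ (B : Fin d → Ω → ℝ) (N : Fin d → ℝ≥0 → Ω → ℕ), IsKacDriver a c B N P ∧
      ∀ t, 0 ≤ t → ∀ ω i, K t ω i = B i ω * (c * primitive direction (N i) t ω) := by
  choose B N hBm hB hN hBN hKt using hK.component
  refine ⟨B, N, ⟨hBm, hB, hN, hBN, ?_⟩, fun t ht ω i => hKt i t ht ω⟩
  convert hK.indep using 4 with i ω t
  exact (hKt i t t.2 ω).symm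

/-- The position at time `t` of the process with the given signs and Poisson processes. -/
noncomputable def kacPosition (c : ℝ) (B : Fin d → Ω → ℝ) (N : Fin d → ℝ≥0 → Ω → ℕ)
    (x₀ : EuclideanSpace ℝ (Fin d)) (t : ℝ) (ω : Ω) : EuclideanSpace ℝ (Fin d) :=
  WithLp.toLp 2 fun i => x₀ i + B i ω * (c * primitive direction (N i) t ω)

/-- The right derivative of `kacPosition`. -/
noncomputable def kacDirection (c : ℝ) (B : Fin d → Ω → ℝ) (N : Fin d → ℝ≥0 → Ω → ℕ)
    (t : ℝ) (ω : Ω) : EuclideanSpace ℝ (Fin d) :=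
  WithLp.toLp 2 fun i => B i ω * (c * direction (N i t.toNNReal ω))

namespace IsKacDriver

theorem ae_sign (h : IsKacDriver a c B N P) : ∀ᵐ ω ∂P, ∀ i, |B i ω| = 1 := by
  refine ae_all_iff.2 fun i => ?_
  filter_upwards [KacFlow.ae_sign (h.measurable_sign i) (h.law_sign i)] with ω hω
  rcases hω with h | h <;> simp [h]

theorem measurable_position_coord (h : IsKacDriver a c B N P) (i : Fin d) :
    Measurable fun p : ℝ × Ω => B i p.2 * (c * primitive direction (N i) p.1 p.2) :=
  ((h.measurable_sign i).comp measurable_snd).mul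
    (((h.poisson i).measurable_uncurry_primitive abs_direction_le).const_mul c)

theorem measurable_direction_coord (h : IsKacDriver a c B N P) (i : Fin d) :
    Measurable fun p : ℝ × Ω => B i p.2 * (c * direction (N i p.1.toNNReal p.2)) :=
  ((h.measurable_sign i).comp measurable_snd).mul
    (((Measurable.of_discrete (f := direction)).comp
      (h.poisson i).measurable_uncurry).const_mul c)

theorem measurable_uncurry_kacPosition (h : IsKacDriver a c B N P)
    (x₀ : EuclideanSpace ℝ (Fin d)) :
    Measurable fun p : ℝ × Ω => kacPosition c B N x₀ p.1 p.2 :=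
  (WithLp.measurable_toLp 2 _).comp
    (measurable_pi_iff.2 fun i => (h.measurable_position_coord i).const_add (x₀ i))

theorem measurable_uncurry_kacDirection (h : IsKacDriver a c B N P) :
    Measurable fun p : ℝ × Ω => kacDirection c B N p.1 p.2 :=
  (WithLp.measurable_toLp 2 _).comp
    (measurable_pi_iff.2 fun i => h.measurable_direction_coord i)

theorem measurable_kacPosition (h : IsKacDriver a c B N P)
    (x₀ : EuclideanSpace ℝ (Fin d)) (t : ℝ) : Measurable (kacPosition c B N x₀ t) :=
  (h.measurable_uncurry_kacPosition x₀).comp (measurable_const.prodMk measurable_id)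

theorem measurable_kacDirection (h : IsKacDriver a c B N P) (t : ℝ) :
    Measurable (kacDirection c B N t) :=
  h.measurable_uncurry_kacDirection.comp (measurable_const.prodMk measurable_id)

theorem continuous_kacPosition (h : IsKacDriver a c B N P)
    (x₀ : EuclideanSpace ℝ (Fin d)) (ω : Ω) : Continuous fun t => kacPosition c B N x₀ t ω := by
  refine (PiLp.continuous_toLp 2 _).comp (continuous_pi fun i => ?_)
  exact continuous_const.add (continuous_const.mul (continuous_const.mul
    ((h.poisson i).continuous_primitive abs_direction_le ω)))

theorem hasDerivWithinAt_position_coord (h : IsKacDriver a c B N P) (i : Fin d) (t : ℝ) (ω : Ω) :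
    HasDerivWithinAt (fun t => B i ω * (c * primitive direction (N i) t ω))
      (B i ω * (c * direction (N i t.toNNReal ω))) (Ici t) t :=
  (((h.poisson i).hasDerivWithinAt_primitive abs_direction_le ω t).const_mul c).const_mul (B i ω)

theorem hasDerivWithinAt_kacPosition (h : IsKacDriver a c B N P)
    (x₀ : EuclideanSpace ℝ (Fin d)) (t : ℝ) (ω : Ω) :
    HasDerivWithinAt (fun t => kacPosition c B N x₀ t ω) (kacDirection c B N t ω) (Ici t) t := by
  rw [hasDerivWithinAt_iff_hasFDerivWithinAt, hasFDerivWithinAt_euclidean]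
  intro i
  convert! ((h.hasDerivWithinAt_position_coord i t ω).const_add (x₀ i)).hasFDerivWithinAt using 1

theorem abs_primitive_direction_le {Ω : Type*} (N : ℝ≥0 → Ω → ℕ) {t : ℝ} (ht : 0 ≤ t) (ω : Ω) :
    |primitive direction N t ω| ≤ t := by
  simpa using IsPoissonProcess.abs_primitive_le (N := N) abs_direction_le ω ht

/-- Only the signs cause an exceptional set, so one null set serves all times. -/
theorem ae_kacPosition_mem (h : IsKacDriver a c B N P)
    (x₀ : EuclideanSpace ℝ (Fin d)) :
    ∀ᵐ ω ∂P, ∀ t, 0 ≤ t → ∀ i, ∃ y ∈ Icc (-t) t, kacPosition c B N x₀ t ω i = x₀ i + c * y := by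
  filter_upwards [h.ae_sign] with ω hω t ht i
  refine ⟨B i ω * primitive direction (N i) t ω, abs_le.1 ?_, ?_⟩
  · rw [abs_mul, hω, one_mul]
    exact abs_primitive_direction_le _ ht ω
  · simp only [kacPosition]
    ring

theorem ae_abs_kacDirection (h : IsKacDriver a c B N P) (hc : 0 < c) :
    ∀ᵐ ω ∂P, ∀ t i, |kacDirection c B N t ω i| = c := by
  filter_upwards [h.ae_sign] with ω hω t i
  simp only [kacDirection, abs_mul, hω, abs_direction, abs_of_pos hc, one_mul, mul_one]

/-- The direction of a component is determined by the path of this component. -/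
theorem measurable_direction_comap (h : IsKacDriver a c B N P) (i : Fin d) {t : ℝ} (ht : 0 ≤ t) :
    Measurable[MeasurableSpace.comap
      (fun ω (t : ℝ≥0) => B i ω * (c * primitive direction (N i) t ω)) inferInstance]
      fun ω => B i ω * (c * direction (N i t.toNNReal ω)) := by
  refine measurable_of_hasDerivWithinAt (m := MeasurableSpace.comap _ _) (fun s hs => ?_)
    (h.hasDerivWithinAt_position_coord i t)
  have h1 : Measurable fun x : ℝ≥0 → ℝ => x ⟨s, ht.trans hs⟩ := measurable_pi_apply _
  exact h1.comp (comap_measurable _)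

/-- In the mean, the direction of motion can be replaced by the velocity field. -/
theorem integral_mul_direction_sub_velocity [IsProbabilityMeasure P] (h : IsKacDriver a c B N P)
    (ha : 0 < a) (hc : 0 < c) {g : Fin d → ℝ × ℝ → ℝ} (hg : ∀ i, Measurable (g i))
    (x₀ : EuclideanSpace ℝ (Fin d)) {t : ℝ} (ht : 0 < t)
    {ψ : EuclideanSpace ℝ (Fin d) → ℝ} (hψ : Measurable ψ) {C : ℝ} (hC : ∀ x, |ψ x| ≤ C)
    (i : Fin d) :
    ∫ ω, ψ (kacPosition c B N x₀ t ω) * (kacDirection c B N t ω i -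
      kacVelocity a c (g i) (x₀ i) t (kacPosition c B N x₀ t ω i)) ∂P = 0 := by
  let Y : Fin d → Ω → ℝ≥0 → ℝ := fun i ω t => B i ω * (c * primitive direction (N i) t ω)
  have hYm : ∀ i, Measurable (Y i) := fun i => measurable_pi_iff.2 fun t =>
    (h.measurable_position_coord i).comp (measurable_const.prodMk measurable_id)
  have hYt : ∀ j, Measurable[MeasurableSpace.comap (Y j) inferInstance]
      fun ω => B j ω * (c * primitive direction (N j) t ω) := fun j => by
    have h1 : Measurable fun x : ℝ≥0 → ℝ => x ⟨t, ht.le⟩ := measurable_pi_apply _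
    exact h1.comp (comap_measurable _)
  -- `Z` holds displacement and direction of component i, `V` the other displacements with 0 in
  -- place i.
  let Z : Ω → ℝ × ℝ := fun ω =>
    (B i ω * (c * primitive direction (N i) t ω), B i ω * (c * direction (N i t.toNNReal ω)))
  let V : Ω → Fin d → ℝ := fun ω j =>
    if j = i then 0 else B j ω * (c * primitive direction (N j) t ω)
  have hZY : Measurable[MeasurableSpace.comap (Y i) inferInstance] Z :=
    (hYt i).prodMk (h.measurable_direction_comap i ht.le)
  have hZm : Measurable Z := hZY.mono (hYm i).comap_le le_rfl
  let S : Finset (Fin d) := Finset.univ.erase i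
  have hVY : Measurable[MeasurableSpace.comap (fun ω (j : S) => Y j ω) inferInstance] V := by
    have hgen : ∀ m : MeasurableSpace Ω, (∀ j, j ≠ i →
        Measurable[m] fun ω => B j ω * (c * primitive direction (N j) t ω)) → Measurable[m] V := by
      intro m hm
      refine measurable_pi_iff.2 fun j => ?_
      by_cases hj : j = i
      · simp only [V, if_pos hj]
        exact measurable_const
      · simp only [V, if_neg hj]
        exact hm j hj
    refine hgen _ fun j hj => ?_
    have h1 : Measurable fun x : S → ℝ≥0 → ℝ =>
        x ⟨j, Finset.mem_erase.2 ⟨hj, Finset.mem_univ j⟩⟩ ⟨t, ht.le⟩ :=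
      (measurable_pi_apply _).comp (measurable_pi_apply _)
    exact h1.comp (comap_measurable _)
  have hVm : Measurable V := hVY.mono
    (measurable_pi_iff.2 fun j => hYm _).comap_le le_rfl
  have hZV : IndepFun Z V P := by
    have h1 := h.indep_components.indepFun_finset {i} S (by simp [S]) hYm
    refine indep_of_indep_of_le_right (indep_of_indep_of_le_left h1 ?_) hVY.comap_le
    refine hZY.comap_le.trans (Measurable.comap_le ?_)
    have h2 : Measurable fun x : ({i} : Finset (Fin d)) → ℝ≥0 → ℝ => x ⟨i, by simp⟩ :=
      measurable_pi_apply _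
    exact h2.comp (comap_measurable _)
  let ext : ℝ → (Fin d → ℝ) → EuclideanSpace ℝ (Fin d) := fun k v =>
    WithLp.toLp 2 fun j => x₀ j + if j = i then k else v j
  have hext : Measurable fun p : ℝ × (Fin d → ℝ) => ext p.1 p.2 := by
    refine (WithLp.measurable_toLp 2 _).comp (measurable_pi_iff.2 fun j => ?_)
    split_ifs <;> fun_prop
  have hextV : ∀ ω, ext (Z ω).1 (V ω) = kacPosition c B N x₀ t ω := fun ω => by
    ext j
    by_cases hj : j = i
    · subst hj; simp [ext, Z, kacPosition]
    · simp [ext, V, kacPosition, hj]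
  let Φ : ℝ × ℝ → (Fin d → ℝ) → ℝ := fun z v =>
    ψ (ext z.1 v) * (z.2 - kacVelocity a c (g i) (x₀ i) t (x₀ i + z.1))
  have hvm : Measurable fun y : ℝ => kacVelocity a c (g i) (x₀ i) t (x₀ i + y) := by
    have h1 : Measurable fun y : ℝ => (t, x₀ i + y) := by fun_prop
    exact (measurable_kacVelocity (hg i)).comp h1
  have hΦ : Measurable fun p : (ℝ × ℝ) × (Fin d → ℝ) => Φ p.1 p.2 := by
    have h1 : Measurable fun p : (ℝ × ℝ) × (Fin d → ℝ) => (p.1.1, p.2) := by fun_prop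
    have h2 : Measurable fun p : (ℝ × ℝ) × (Fin d → ℝ) => p.1.1 := by fun_prop
    have h3 : Measurable fun p : (ℝ × ℝ) × (Fin d → ℝ) => p.1.2 := by fun_prop
    exact (hψ.comp (hext.comp h1)).mul (h3.sub (hvm.comp h2))
  have e : ∀ ω, ψ (kacPosition c B N x₀ t ω) * (kacDirection c B N t ω i -
      kacVelocity a c (g i) (x₀ i) t (kacPosition c B N x₀ t ω i)) = Φ (Z ω) (V ω) := fun ω => by
    simp only [Φ, hextV]
    rfl
  simp_rw [e]
  refine integral_eq_zero_of_indepFun hZm hVm hZV hΦ ?_ fun v => ?_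
  · refine Integrable.of_bound (hΦ.comp (hZm.prodMk hVm)).aestronglyMeasurable (C * (c + c)) ?_
    filter_upwards [h.ae_kacPosition_mem x₀, h.ae_abs_kacDirection hc] with ω h1 h2
    obtain ⟨y, hy, hxy⟩ := h1 t ht.le i
    rw [← e, norm_mul, hxy]
    refine mul_le_mul (hC _) ((abs_sub _ _).trans (add_le_add (h2 t i).le ?_)) (norm_nonneg _)
      ((abs_nonneg _).trans (hC 0))
    exact abs_kacVelocity_le ha hc ht hy
  -- With the other coordinates frozen, this is the one-dimensional statement for the test function
  -- k ↦ ψ (ext k v).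
  · have hf : Measurable fun k => ψ (ext k v) :=
      hψ.comp (hext.comp (measurable_id.prodMk measurable_const))
    exact integral_mul_velocity_sub ha hc (h.measurable_sign i) (h.law_sign i) (h.poisson i)
      (h.indep_sign i) (hg i) (x₀ i) ht hf (fun k => hC _)

theorem measurable_velocity {x₀ : EuclideanSpace ℝ (Fin d)} {g : Fin d → ℝ × ℝ → ℝ}
    (hg : ∀ i, Measurable (g i)) :
    Measurable fun p : ℝ × EuclideanSpace ℝ (Fin d) =>
      (WithLp.toLp 2 fun i => kacVelocity a c (g i) (x₀ i) p.1 (p.2 i) :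
        EuclideanSpace ℝ (Fin d)) := by
  refine (WithLp.measurable_toLp 2 _).comp (measurable_pi_iff.2 fun i => ?_)
  have h1 : Measurable fun p : ℝ × EuclideanSpace ℝ (Fin d) => (p.1, p.2 i) := by fun_prop
  exact (measurable_kacVelocity (hg i)).comp h1

section Test

variable {φ : ℝ × EuclideanSpace ℝ (Fin d) → ℝ}

theorem continuous_fderiv_apply (hφ : ContDiff ℝ ((⊤ : ℕ∞) : WithTop ℕ∞) φ) :
    Continuous fun p : (ℝ × EuclideanSpace ℝ (Fin d)) × EuclideanSpace ℝ (Fin d) =>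
      fderiv ℝ φ p.1 (1, p.2) :=
  ((hφ.continuous_fderiv (by simp)).comp continuous_fst).clm_apply
    (continuous_const.prodMk continuous_snd)

/-- In the mean along a test function, the velocity field can be replaced by the direction of
motion. -/
theorem integral_fderiv_velocity [IsProbabilityMeasure P] (h : IsKacDriver a c B N P)
    (ha : 0 < a) (hc : 0 < c) {g : Fin d → ℝ × ℝ → ℝ} (hg : ∀ i, Measurable (g i))
    (x₀ : EuclideanSpace ℝ (Fin d)) {t : ℝ} (ht : 0 < t)
    (hφ : ContDiff ℝ ((⊤ : ℕ∞) : WithTop ℕ∞) φ) {C : ℝ} (hC : ∀ p, ‖fderiv ℝ φ p‖ ≤ C) :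
    ∫ ω, fderiv ℝ φ (t, kacPosition c B N x₀ t ω) (1, WithLp.toLp 2 fun i =>
        kacVelocity a c (g i) (x₀ i) t (kacPosition c B N x₀ t ω i)) ∂P =
      ∫ ω, fderiv ℝ φ (t, kacPosition c B N x₀ t ω) (1, kacDirection c B N t ω) ∂P := by
  have hX := h.measurable_kacPosition x₀ t
  have hD := h.measurable_kacDirection t
  have hC0 : 0 ≤ C := (norm_nonneg _).trans (hC 0)
  let ψ : Fin d → EuclideanSpace ℝ (Fin d) → ℝ := fun i x =>
    fderiv ℝ φ (t, x) (0, EuclideanSpace.single i 1)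
  have hψ : ∀ i, Measurable (ψ i) := fun i => by
    have h1 : Continuous (ψ i) :=
      ((hφ.continuous_fderiv (by simp)).comp (by fun_prop)).clm_apply continuous_const
    exact h1.measurable
  have hψC : ∀ i x, |ψ i x| ≤ C := fun i x => by
    have h1 := (fderiv ℝ φ (t, x)).le_opNorm (0, EuclideanSpace.single i 1)
    have h2 : ‖((0 : ℝ), EuclideanSpace.single i (1 : ℝ))‖ = 1 := by
      simp [Prod.norm_def]
    rw [h2, mul_one] at h1
    exact h1.trans (hC _)
  -- The total derivative is affine in the velocity, so exchanging velocities costs one term per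
  -- partial derivative ψ i, each of mean zero.
  have hlin : ∀ x w w' : EuclideanSpace ℝ (Fin d), fderiv ℝ φ (t, x) (1, w) =
      fderiv ℝ φ (t, x) (1, w') - ∑ i, ψ i x * (w' i - w i) := fun x w w' => by
    have h1 : ((1 : ℝ), w') = (1, w) + ∑ i, (w' i - w i) •
        ((0 : ℝ), (EuclideanSpace.single i 1 : EuclideanSpace ℝ (Fin d))) := by
      refine Prod.ext ?_ ?_
      · simp [Prod.fst_sum]
      · ext j
        simp [Prod.snd_sum, Pi.single_apply]
    have h2 := congrArg (fderiv ℝ φ (t, x)) h1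
    rw [map_add, map_sum] at h2
    simp only [map_smul, smul_eq_mul] at h2
    rw [h2, eq_sub_iff_add_eq, add_right_inj]
    exact Finset.sum_congr rfl fun i _ => mul_comm _ _
  have e : ∀ ω, fderiv ℝ φ (t, kacPosition c B N x₀ t ω) (1, WithLp.toLp 2 fun i =>
        kacVelocity a c (g i) (x₀ i) t (kacPosition c B N x₀ t ω i)) =
      fderiv ℝ φ (t, kacPosition c B N x₀ t ω) (1, kacDirection c B N t ω) -
        ∑ i, ψ i (kacPosition c B N x₀ t ω) * (kacDirection c B N t ω i -
          kacVelocity a c (g i) (x₀ i) t (kacPosition c B N x₀ t ω i)) :=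
    fun ω => hlin _ _ _
  simp_rw [e]
  have hterm : ∀ i, Integrable (fun ω => ψ i (kacPosition c B N x₀ t ω) *
      (kacDirection c B N t ω i -
        kacVelocity a c (g i) (x₀ i) t (kacPosition c B N x₀ t ω i))) P := fun i => by
    have hDi : Measurable fun ω => kacDirection c B N t ω i :=
      (EuclideanSpace.proj i : EuclideanSpace ℝ (Fin d) →L[ℝ] ℝ).measurable.comp hD
    have hXi : Measurable fun ω => (t, kacPosition c B N x₀ t ω i) := measurable_const.prodMk
      ((EuclideanSpace.proj i : EuclideanSpace ℝ (Fin d) →L[ℝ] ℝ).measurable.comp hX)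
    refine Integrable.of_bound (((hψ i).comp hX).mul (hDi.sub
      ((measurable_kacVelocity (hg i)).comp hXi))).aestronglyMeasurable (C * (c + c)) ?_
    filter_upwards [h.ae_kacPosition_mem x₀, h.ae_abs_kacDirection hc] with ω h1 h2
    obtain ⟨y, hy, hxy⟩ := h1 t ht.le i
    rw [norm_mul, hxy]
    exact mul_le_mul (hψC _ _) ((abs_sub _ _).trans (add_le_add (h2 t i).le
      (abs_kacVelocity_le ha hc ht hy))) (norm_nonneg _) hC0
  have hmain : Integrable (fun ω =>
      fderiv ℝ φ (t, kacPosition c B N x₀ t ω) (1, kacDirection c B N t ω)) P := by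
    have h0 := (continuous_fderiv_apply hφ).measurable.comp
      ((measurable_const (a := t)).prodMk hX |>.prodMk hD)
    refine Integrable.of_bound h0.aestronglyMeasurable
      (C * max 1 (Real.sqrt (d * c ^ 2))) ?_
    filter_upwards [h.ae_abs_kacDirection hc] with ω h2
    refine ((fderiv ℝ φ _).le_opNorm _).trans (mul_le_mul (hC _) ?_ (norm_nonneg _) hC0)
    rw [Prod.norm_def, norm_one]
    exact max_le_max le_rfl (euclidean_norm_le fun i => (h2 t i).le)
  rw [integral_sub hmain (integrable_finsetSum _ fun i _ => hterm i),
    integral_finsetSum _ fun i _ => hterm i, Finset.sum_eq_zero, sub_zero]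
  exact fun i _ => h.integral_mul_direction_sub_velocity ha hc hg x₀ ht (hψ i) (hψC i) i

/-- The distributional time derivative of the flow along the directions of motion. -/
theorem integral_integral_fderiv_direction [IsProbabilityMeasure P] (h : IsKacDriver a c B N P)
    (hc : 0 < c) (x₀ : EuclideanSpace ℝ (Fin d))
    (hφ : ContDiff ℝ ((⊤ : ℕ∞) : WithTop ℕ∞) φ) {C : ℝ} (hC : ∀ p, ‖fderiv ℝ φ p‖ ≤ C)
    {T : ℝ} (hT : 0 ≤ T) (h0 : ∀ x, φ (0, x) = 0) (hφT : ∀ x, φ (T, x) = 0) :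
    ∫ t in Ioc 0 T, ∫ ω, fderiv ℝ φ (t, kacPosition c B N x₀ t ω)
      (1, kacDirection c B N t ω) ∂P = 0 := by
  have hC0 : 0 ≤ C := (norm_nonneg _).trans (hC 0)
  have hm : Measurable fun p : ℝ × Ω => fderiv ℝ φ (p.1, kacPosition c B N x₀ p.1 p.2)
      (1, kacDirection c B N p.1 p.2) :=
    (continuous_fderiv_apply hφ).measurable.comp
      ((measurable_fst.prodMk (h.measurable_uncurry_kacPosition x₀)).prodMk
        h.measurable_uncurry_kacDirection)
  -- The product carries the maximum norm, whence the maximum of 1 and the bound on the speed.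
  have hb : ∀ᵐ ω ∂P, ∀ t, ‖fderiv ℝ φ (t, kacPosition c B N x₀ t ω)
      (1, kacDirection c B N t ω)‖ ≤ C * max 1 (Real.sqrt (d * c ^ 2)) := by
    filter_upwards [h.ae_abs_kacDirection hc] with ω h2 t
    refine ((fderiv ℝ φ _).le_opNorm _).trans (mul_le_mul (hC _) ?_ (norm_nonneg _) hC0)
    rw [Prod.norm_def, norm_one]
    exact max_le_max le_rfl (euclidean_norm_le fun i => (h2 t i).le)
  rw [integral_integral_swap]
  · refine integral_eq_zero_of_ae ?_
    filter_upwards [hb] with ω hω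
    refine integral_test_along_path hφ hT h0 hφT (h.continuous_kacPosition x₀ ω)
      (fun t => h.hasDerivWithinAt_kacPosition x₀ t ω) ?_
    refine (intervalIntegrable_const (c := C * max 1 (Real.sqrt (d * c ^ 2)))).mono_fun
      (hm.comp (measurable_id.prodMk measurable_const)).aestronglyMeasurable
      (Eventually.of_forall fun t => (hω t).trans (le_abs_self _))
  · refine Integrable.of_bound hm.aestronglyMeasurable
      (C * max 1 (Real.sqrt (d * c ^ 2))) ?_
    have := Measure.quasiMeasurePreserving_snd (μ := volume.restrict (Ioc 0 T)) (ν := P) |>.ae hb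
    filter_upwards [this] with p hp
    exact hp p.1

end Test

end IsKacDriver

/-! ### The continuity equation. -/

/-- The continuity equation for the laws of a Kac process. -/
theorem satisfiesContinuityEquation [IsProbabilityMeasure P] (ha : 0 < a) (hc : 0 < c) (h : IsKacDriver a c B N P)
    (x₀ : EuclideanSpace ℝ (Fin d)) {X : ℝ → Ω → EuclideanSpace ℝ (Fin d)}
    (hX : ∀ t, 0 ≤ t → X t = kacPosition c B N x₀ t)
    {g : Fin d → ℝ × ℝ → ℝ} (hg : ∀ i, Measurable (g i)) :
    SatisfiesContinuityEquation (fun t => P.map (X t))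
      (fun t x => WithLp.toLp 2 fun i => kacVelocity a c (g i) (x₀ i) t (x i)) where
  isProbabilityMeasure t ht := by
    rw [hX t ht]
    exact Measure.isProbabilityMeasure_map (h.measurable_kacPosition x₀ t).aemeasurable
  second_moment t ht := by
    rw [hX t ht]
    have hm := h.measurable_kacPosition x₀ t
    have := Measure.isProbabilityMeasure_map (μ := P) hm.aemeasurable
    refine MemLp.of_bound aestronglyMeasurable_id (‖x₀‖ + Real.sqrt (d * (c * t) ^ 2)) ?_
    refine (ae_map_iff hm.aemeasurable (measurableSet_le (by fun_prop) (by fun_prop))).2 ?_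
    filter_upwards [h.ae_kacPosition_mem x₀] with ω hω
    have h1 : ‖kacPosition c B N x₀ t ω - x₀‖ ≤ Real.sqrt (d * (c * t) ^ 2) := by
      refine euclidean_norm_le fun i => ?_
      obtain ⟨y, hy, hxy⟩ := hω t ht i
      rw [PiLp.sub_apply, hxy, add_sub_cancel_left, abs_mul, abs_of_pos hc]
      exact mul_le_mul_of_nonneg_left (abs_le.2 hy) hc.le
    calc ‖id (kacPosition c B N x₀ t ω)‖ = ‖x₀ + (kacPosition c B N x₀ t ω - x₀)‖ := by simp
      _ ≤ _ := (norm_add_le _ _).trans (by gcongr)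
  narrowly_continuous f := by
    have h1 : ∀ t ∈ Ici (0 : ℝ), ∫ x, f x ∂(P.map (X t)) =
        ∫ ω, f (kacPosition c B N x₀ t ω) ∂P := fun t ht => by
      rw [hX t ht, integral_map (h.measurable_kacPosition x₀ t).aemeasurable
        f.continuous.aestronglyMeasurable]
    refine ContinuousOn.congr (Continuous.continuousOn ?_) h1
    refine continuous_of_dominated (bound := fun _ => ‖f‖)
      (fun t => (f.continuous.measurable.comp
        (h.measurable_kacPosition x₀ t)).aestronglyMeasurable)
      (fun t => Eventually.of_forall fun ω => f.norm_coe_le_norm _) (integrable_const _)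
      (Eventually.of_forall fun ω => f.continuous.comp (h.continuous_kacPosition x₀ ω))
  measurable_velocity := IsKacDriver.measurable_velocity hg
  velocity_bound T := by
    have hb : ∀ t ∈ Ioo 0 T, ∫⁻ x, ‖(WithLp.toLp 2 fun i =>
        kacVelocity a c (g i) (x₀ i) t (x i) : EuclideanSpace ℝ (Fin d))‖ₑ ^ 2 ∂(P.map (X t)) ≤
        ENNReal.ofReal (Real.sqrt (d * c ^ 2)) ^ 2 := by
      intro t ht
      rw [hX t ht.1.le]
      have hm := h.measurable_kacPosition x₀ t
      have hv : Measurable fun x : EuclideanSpace ℝ (Fin d) => (WithLp.toLp 2 fun i =>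
          kacVelocity a c (g i) (x₀ i) t (x i) : EuclideanSpace ℝ (Fin d)) :=
        (IsKacDriver.measurable_velocity (x₀ := x₀) hg).comp
          ((measurable_const (a := t)).prodMk measurable_id)
      rw [lintegral_map (hv.enorm.pow_const 2) hm]
      calc _ ≤ ∫⁻ _, ENNReal.ofReal (Real.sqrt (d * c ^ 2)) ^ 2 ∂P := by
            refine lintegral_mono_ae ?_
            filter_upwards [h.ae_kacPosition_mem x₀] with ω hω
            gcongr
            rw [← ofReal_norm]
            refine ENNReal.ofReal_le_ofReal (euclidean_norm_le fun i => ?_)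
            obtain ⟨y, hy, hxy⟩ := hω t ht.1.le i
            simp only [hxy]
            exact abs_kacVelocity_le ha hc ht.1 hy
        _ = _ := by simp
    refine (setLIntegral_mono measurable_const hb).trans_lt ?_
    rw [setLIntegral_const]
    exact ENNReal.mul_lt_top (ENNReal.pow_lt_top ENNReal.ofReal_lt_top) (by simp)
  equation φ hφ hcs hsupp := by
    have hd : Differentiable ℝ φ := hφ.differentiable (by simp)
    obtain ⟨C, hC⟩ := (hφ.continuous_fderiv (by simp)).bounded_above_of_compact_support
      (hcs.fderiv (𝕜 := ℝ))
    obtain ⟨T, hT, hTs⟩ := exists_time_bound hcs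
    have h0 : ∀ x, φ (0, x) = 0 := fun x =>
      image_eq_zero_of_notMem_tsupport fun hmem => lt_irrefl (0 : ℝ) (hsupp hmem).1
    have hφT : ∀ x, φ (T, x) = 0 := fun x =>
      image_eq_zero_of_notMem_tsupport (hTs T x le_rfl)
    simp_rw [deriv_add_inner_gradient hd]
    refine Eq.trans ?_ (h.integral_integral_fderiv_direction hc x₀ hφ hC hT h0 hφT)
    -- From T on, the points lie outside the topological support of φ, so its derivative vanishes
    -- there too.
    rw [setIntegral_eq_of_subset_of_forall_sdiff_eq_zero measurableSet_Ioi
        (show Ioc 0 T ⊆ Ioi 0 from fun t ht => ht.1)]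
    · refine setIntegral_congr_fun measurableSet_Ioc fun t ht => ?_
      have hmeas : Measurable fun x : EuclideanSpace ℝ (Fin d) => fderiv ℝ φ (t, x)
          (1, WithLp.toLp 2 fun i => kacVelocity a c (g i) (x₀ i) t (x i)) :=
        (IsKacDriver.continuous_fderiv_apply hφ).measurable.comp
          ((measurable_const.prodMk measurable_id).prodMk
            ((IsKacDriver.measurable_velocity (x₀ := x₀) hg).comp
              (measurable_const.prodMk measurable_id)))
      rw [← h.integral_fderiv_velocity ha hc hg x₀ ht.1 hφ hC]
      simp only
      rw [hX t ht.1.le, integral_map (h.measurable_kacPosition x₀ t).aemeasurable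
        hmeas.aestronglyMeasurable]
    · intro t ht
      have h1 : T ≤ t := by
        by_contra hlt
        exact ht.2 ⟨ht.1, (not_le.1 hlt).le⟩
      refine integral_eq_zero_of_ae (Eventually.of_forall fun x => ?_)
      simp [fderiv_of_notMem_tsupport ℝ (hTs t x h1)]

/-! ### The conditional expectation of the derivative. -/

namespace IsKacDriver

theorem ae_hasDerivAt_coord [IsProbabilityMeasure P] (h : IsKacDriver a c B N P) (ha : 0 < a)
    (x₀ : EuclideanSpace ℝ (Fin d)) {X : ℝ → Ω → EuclideanSpace ℝ (Fin d)}
    (hX : ∀ t, 0 ≤ t → X t = kacPosition c B N x₀ t) {t : ℝ} (ht : 0 < t) (i : Fin d) :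
    ∀ᵐ ω ∂P, HasDerivAt (fun s => X s ω i) (kacDirection c B N t ω i) t := by
  filter_upwards [(h.poisson i).ae_hasDerivAt_primitive ha abs_direction_le ht] with ω hω
  refine (((hω.const_mul c).const_mul (B i ω)).const_add (x₀ i)).congr_of_eventuallyEq ?_
  filter_upwards [lt_mem_nhds ht] with s hs
  rw [hX s hs.le]
  rfl

/-- The velocity field is the conditional expectation of the derivative of the path. -/
theorem condExp_deriv [IsProbabilityMeasure P] (h : IsKacDriver a c B N P) (ha : 0 < a)
    (hc : 0 < c) (x₀ : EuclideanSpace ℝ (Fin d)) {X : ℝ → Ω → EuclideanSpace ℝ (Fin d)}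
    (hX : ∀ t, 0 ≤ t → X t = kacPosition c B N x₀ t) {g : Fin d → ℝ × ℝ → ℝ}
    (hg : ∀ i, Measurable (g i)) {t : ℝ} (ht : 0 < t) (i : Fin d)
    (hint : Integrable (fun ω => deriv (fun s => X s ω i) t) P) :
    P[fun ω => deriv (fun s => X s ω i) t |
        MeasurableSpace.comap (fun ω => (X t ω i, X 0 ω i)) inferInstance]
      =ᵐ[P] fun ω => kacVelocity a c (g i) (x₀ i) t (X t ω i) := by
  have hm : ∀ t, 0 ≤ t → Measurable fun ω => X t ω i := fun t ht => by
    rw [hX t ht]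
    exact (EuclideanSpace.proj i : EuclideanSpace ℝ (Fin d) →L[ℝ] ℝ).measurable.comp
      (h.measurable_kacPosition x₀ t)
  have hX0 : ∀ ω, X 0 ω i = x₀ i := fun ω => by
    rw [hX 0 le_rfl]
    simp [kacPosition, primitive]
  have hv : Measurable fun x => kacVelocity a c (g i) (x₀ i) t x :=
    (measurable_kacVelocity (hg i)).comp (measurable_const.prodMk measurable_id)
  have hpair : Measurable fun ω => (X t ω i, X 0 ω i) := (hm t ht.le).prodMk (hm 0 le_rfl)
  have hvi : Integrable (fun ω => kacVelocity a c (g i) (x₀ i) t (X t ω i)) P := by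
    refine Integrable.of_bound (hv.comp (hm t ht.le)).aestronglyMeasurable c ?_
    filter_upwards [h.ae_kacPosition_mem x₀] with ω hω
    obtain ⟨y, hy, hxy⟩ := hω t ht.le i
    rw [hX t ht.le, hxy]
    exact abs_kacVelocity_le ha hc ht hy
  refine (ae_eq_condExp_of_forall_setIntegral_eq hpair.comap_le hint
    (fun s _ _ => hvi.integrableOn) (fun s hs _ => ?_) ?_).symm
  · obtain ⟨A, hA, rfl⟩ := hs
    have hs := hpair hA
    rw [eq_comm, ← sub_eq_zero, ← integral_sub hint.integrableOn hvi.integrableOn,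
      ← integral_indicator hs]
    -- As X 0 is the constant x₀, an event of the conditioning σ-algebra depends on coordinate i of
    -- X t alone; its indicator is a bounded test function.
    let ψ : EuclideanSpace ℝ (Fin d) → ℝ :=
      ((fun x : EuclideanSpace ℝ (Fin d) => (x i, x₀ i)) ⁻¹' A).indicator 1
    have hψ : Measurable ψ := by
      have h1 : Measurable fun x : EuclideanSpace ℝ (Fin d) => (x i, x₀ i) := by fun_prop
      exact measurable_one.indicator (h1 hA)
    have hψ1 : ∀ x, |ψ x| ≤ 1 := fun x => by
      by_cases hx : x ∈ (fun x : EuclideanSpace ℝ (Fin d) => (x i, x₀ i)) ⁻¹' A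
      · simp [ψ, Set.indicator_of_mem hx]
      · simp [ψ, Set.indicator_of_notMem hx]
    refine Eq.trans ?_ (h.integral_mul_direction_sub_velocity ha hc hg x₀ ht hψ hψ1 i)
    refine integral_congr_ae ?_
    filter_upwards [h.ae_hasDerivAt_coord ha x₀ hX ht i] with ω hω
    rw [← hX t ht.le, ← hω.deriv]
    by_cases hx : (X t ω i, x₀ i) ∈ A
    · have h1 : ω ∈ (fun ω => (X t ω i, X 0 ω i)) ⁻¹' A := by
        simpa only [mem_preimage, hX0] using hx
      have h2 : ψ (X t ω) = 1 := Set.indicator_of_mem (show X t ω ∈ _ from hx) _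
      rw [Set.indicator_of_mem h1, h2, one_mul]
    · have h1 : ω ∉ (fun ω => (X t ω i, X 0 ω i)) ⁻¹' A := by
        simpa only [mem_preimage, hX0] using hx
      have h2 : ψ (X t ω) = 0 := Set.indicator_of_notMem (show X t ω ∉ _ from hx) _
      rw [Set.indicator_of_notMem h1, h2, zero_mul]
  · refine StronglyMeasurable.aestronglyMeasurable (Measurable.stronglyMeasurable ?_)
    exact hv.comp (measurable_fst.comp (comap_measurable _))

end IsKacDriver

end KacFlow

/-! ### The main theorem. -/

theorem theorem6p2 {Ω : Type*} [MeasurableSpace Ω] (P : Measure Ω) [IsProbabilityMeasure P]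
    {d : ℕ} {a c : ℝ} (ha : 0 < a) (hc : 0 < c)
    (K : ℝ → Ω → EuclideanSpace ℝ (Fin d)) (hK : KacFlow.IsMultiKacProcess a c K P)
    (x₀ : EuclideanSpace ℝ (Fin d))
    (X : ℝ → Ω → EuclideanSpace ℝ (Fin d)) (hX : ∀ t ω, X t ω = x₀ + K t ω)
    (g : Fin d → ℝ × ℝ → ℝ) (hg : ∀ i, Measurable (g i)) :
    KacFlow.SatisfiesContinuityEquation (fun t => P.map (X t))
      (fun t x => WithLp.toLp 2 fun i => KacFlow.kacVelocity a c (g i) (x₀ i) t (x i)) ∧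
    ∀ t : ℝ, 0 < t → ∀ i : Fin d,
      (∀ᵐ ω ∂P, DifferentiableAt ℝ (fun s => X s ω i) t) ∧
      Integrable (fun ω => deriv (fun s => X s ω i) t) P ∧
      Measurable (X t) ∧ Measurable (X 0) ∧
      P[fun ω => deriv (fun s => X s ω i) t |
          MeasurableSpace.comap (fun ω => (X t ω i, X 0 ω i)) inferInstance]
        =ᵐ[P] fun ω => KacFlow.kacVelocity a c (g i) (x₀ i) t (X t ω i) := by
  obtain ⟨B, N, h, hKt⟩ := hK.exists_driver
  have hXt : ∀ t, 0 ≤ t → X t = KacFlow.kacPosition c B N x₀ t := fun t ht => by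
    ext ω i
    rw [hX, PiLp.add_apply, hKt t ht]
    rfl
  refine ⟨KacFlow.satisfiesContinuityEquation ha hc h x₀ hXt hg, fun t ht i => ?_⟩
  have hd := h.ae_hasDerivAt_coord ha x₀ hXt ht i
  -- The derivative agrees almost surely with `kacDirection`, which is measurable and bounded by c.
  have hint : Integrable (fun ω => deriv (fun s => X s ω i) t) P := by
    have hm : Measurable fun ω => KacFlow.kacDirection c B N t ω i :=
      (EuclideanSpace.proj i : EuclideanSpace ℝ (Fin d) →L[ℝ] ℝ).measurable.comp
        (h.measurable_kacDirection t)
    refine (Integrable.of_bound hm.aestronglyMeasurable c ?_).congr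
      (hd.mono fun ω hω => hω.deriv.symm)
    filter_upwards [h.ae_abs_kacDirection hc] with ω hω
    exact (hω t i).le
  refine ⟨hd.mono fun ω hω => hω.differentiableAt, hint, ?_, ?_,
    h.condExp_deriv ha hc x₀ hXt hg ht i hint⟩
  · rw [hXt t ht.le]
    exact h.measurable_kacPosition x₀ t
  · rw [hXt 0 le_rfl]
    exact h.measurable_kacPosition x₀ 0
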